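/- Let $\mu,p,q\ge 1$ be integers with $\gcd(p,q)=1$, and let $L=T(\mu p,\mu q)\subset S^3$ be the $\mu$-component torus link, its components oriented in parallel. Let $G(L)=\pi_1(S^3\setminus L)$ be the link group, and let $\alpha_L:G(L)\to\langle t_1\rangle\oplus\cdots\oplus\langle t_\mu\rangle\cong\mathbb Z^\mu$ be the abelianization that sends each meridian of the $i$-th component to $t_i$. Let $x,y\in G(L)$ be the elements represented by the cores of the two solid tori of the genus one Heegaard splitting of $S^3$ defined by the torus on which $L$ lies, so that $x^p=y^q$, $\alpha_L(x)=t^q$ and $\alpha_L(y)=t^p$, where $t=t_1\cdots t_\mu$. For a representation $\varphi:G(L)\to \mathrm{SL}(n,\mathbb C)$ and a Wirtinger presentation $G(L)=\langle x_1,\ldots,x_l\mid r_1,\ldots,r_{l-1}\rangle$, let $\Phi:\mathbb Z[F_l]\to M(n,\mathbb C[t_1^{\pm1},\ldots,t_\mu^{\pm1}])$ be the ring homomorphism from the group ring of the free group $F_l$ on $x_1,\ldots,x_l$ that is induced by $\varphi\otimes\alpha_L$. Let $A_j$ be the matrix $\bigl(\Phi(\partial r_i/\partial x_k)\bigr)_{i,k}$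 of free derivatives with its $j$-th block column removed. The twisted Alexander polynomial is the rational function $$\Delta_{L,\varphi}(t_1,\ldots,t_\mu)=\frac{\det A_j}{\det\Phi(x_j-1)},$$ considered up to multiplication by $t_1^{nk_1}\cdots t_\mu^{nk_\mu}$ with $k_i\in\mathbb Z$ and, if $n$ is odd, up to sign. For $n\ge1$ let $\sigma_n$ be the representation of $\mathrm{SL}(2,\mathbb C)$ on the $n$-dimensional space of homogeneous polynomials of degree $n-1$ in two variables given by $(P\cdot f)(z)=f(P^{-1}z)$. Let $\rho:G(L)\to\mathrm{SL}(2,\mathbb C)$ be an irreducible representation and $\rho_n=\sigma_n\circ\rho$. Let $a,b$ be integers with $0\le a\le p$, $0\le b\le q$ such that $\rho(x)$ is conjugate to $\mathrm{diag}(\alpha,\alpha^{-1})$ and $\rho(y)$ is conjugate to $\mathrm{diag}(\beta,\beta^{-1})$, where $\alpha=e^{\sqrt{-1}\,\pi a/p}$ and $\beta=e^{\sqrt{-1}\,\pi b/q}$. **Theorem.** If $n$ is even, then $$\Delta_{L,\rho_n}=\frac{\bigl(t^{pq}-(-1)^a\bigr)^{n\mu}}{\prod_{j=0}^{n/2-1}\Bigl(t^{2q}-2\cos\frac{(2j+1)a\pi}{p}\,t^q+1\Bigr)\Bigl(t^{2p}-2\cos\frac{(2j+1)b\pi}{q}\,t^p+1\Bigr)}.$$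 If $n$ is odd, then $$\Delta_{L,\rho_n}=\frac{(t^{pq}-1)^{n\mu}}{(t^p-1)(t^q-1)\prod_{j=1}^{(n-1)/2}\Bigl(t^{2q}-2\cos\frac{2ja\pi}{p}\,t^q+1\Bigr)\Bigl(t^{2p}-2\cos\frac{2jb\pi}{q}\,t^p+1\Bigr)}.$$ -/

import Mathlib

open scoped MatrixGroups

noncomputable section

namespace TorusLink

/-! ### Free differential calculus -/

section Fox

variable {ι : Type*} [DecidableEq ι]

/-- The free derivative `∂/∂x_j` of a (not necessarily reduced) word in the letters `x_i^{±1}`,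
with values in the integral group ring of the free group:
`∂(x_i w) = δ_ij + x_i ∂w` and `∂(x_i⁻¹ w) = - δ_ij x_i⁻¹ + x_i⁻¹ ∂w`. -/
def foxWord (j : ι) : List (ι × Bool) → MonoidAlgebra ℤ (FreeGroup ι)
  | [] => 0
  | (i, true) :: w =>
      (if i = j then 1 else 0) + MonoidAlgebra.of ℤ _ (FreeGroup.of i) * foxWord j w
  | (i, false) :: w =>
      (if i = j then -MonoidAlgebra.of ℤ _ (FreeGroup.of i)⁻¹ else 0) +
        MonoidAlgebra.of ℤ _ (FreeGroup.of i)⁻¹ * foxWord j w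

theorem foxWord_append (j : ι) (u v : List (ι × Bool)) :
    foxWord j (u ++ v) = foxWord j u + MonoidAlgebra.of ℤ _ (FreeGroup.mk u) * foxWord j v := by
  induction u with
  | nil =>
    have h : (FreeGroup.mk [] : FreeGroup ι) = 1 := rfl
    rw [h, map_one]
    simp [foxWord]
  | cons a u ih =>
    obtain ⟨i, ε⟩ := a
    have h : FreeGroup.mk ((i, ε) :: u) = FreeGroup.mk [(i, ε)] * FreeGroup.mk u := rfl
    cases ε
    · have h' : FreeGroup.mk [(i, false)] = (FreeGroup.of i)⁻¹ := rfl
      rw [List.cons_append, foxWord, foxWord, ih, h, h', map_mul]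
      noncomm_ring
    · have h' : FreeGroup.mk [(i, true)] = FreeGroup.of i := rfl
      rw [List.cons_append, foxWord, foxWord, ih, h, h', map_mul]
      noncomm_ring

theorem foxWord_step (j : ι) (u v : List (ι × Bool)) (h : FreeGroup.Red.Step u v) :
    foxWord j u = foxWord j v := by
  obtain @⟨L₁, L₂, i, ε⟩ := h
  have key : foxWord j ((i, ε) :: (i, !ε) :: L₂) = foxWord j L₂ := by
    have h1 : MonoidAlgebra.of ℤ (FreeGroup ι) (FreeGroup.of i) *
        MonoidAlgebra.of ℤ (FreeGroup ι) (FreeGroup.of i)⁻¹ = 1 := by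
      rw [← map_mul, mul_inv_cancel, map_one]
    have h2 : MonoidAlgebra.of ℤ (FreeGroup ι) (FreeGroup.of i)⁻¹ *
        MonoidAlgebra.of ℤ (FreeGroup ι) (FreeGroup.of i) = 1 := by
      rw [← map_mul, inv_mul_cancel, map_one]
    cases ε
    · simp only [Bool.not_false, foxWord, mul_add, ← mul_assoc, h2, one_mul]
      split_ifs <;> simp
    · simp only [Bool.not_true, foxWord, mul_add, ← mul_assoc, h1, one_mul]
      split_ifs
      · rw [mul_neg, h1, ← add_assoc, add_neg_cancel, zero_add]
      · simp
  rw [foxWord_append, foxWord_append, key]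

/-- The free derivative `∂/∂x_j : F → ℤ[F]` on the free group `F` on the `x_i`. -/
def fox (j : ι) : FreeGroup ι → MonoidAlgebra ℤ (FreeGroup ι) :=
  Quot.lift (foxWord j) (foxWord_step j)

theorem fox_of (j i : ι) : fox j (FreeGroup.of i) = if i = j then 1 else 0 := by
  change foxWord j [(i, true)] = _
  simp [foxWord]

theorem fox_mul (j : ι) (u v : FreeGroup ι) :
    fox j (u * v) = fox j u + MonoidAlgebra.of ℤ _ u * fox j v := by
  induction u using Quot.inductionOn with
  | _ u =>
    induction v using Quot.inductionOn with
    | _ v => exact foxWord_append j u v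

end Fox

/-! ### Wada's twisted Alexander invariant -/

section Wada

/-- The field of rational functions `ℂ(t_i : i ∈ τ)`. -/
abbrev RatFun (τ : Type*) : Type _ := FractionRing (MvPolynomial τ ℂ)

/-- The variable `t_i`. -/
def tvar {τ : Type*} (i : τ) : RatFun τ :=
  algebraMap (MvPolynomial τ ℂ) (RatFun τ) (MvPolynomial.X i)

theorem tvar_ne_zero {τ : Type*} (i : τ) : (tvar i : RatFun τ) ≠ 0 := by
  unfold tvar
  rw [Ne, FaithfulSMul.algebraMap_eq_zero_iff]
  exact MvPolynomial.X_ne_zero i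

/-- The Laurent monomial `∏ t_i ^ k_i`. -/
def tmonomial {τ : Type*} [Fintype τ] (k : τ → ℤ) : RatFun τ := ∏ i, tvar i ^ k i

variable {G V τ : Type*} [Group G] [AddCommGroup V] [Module ℂ V] [Fintype τ]

/-- The tensor product of a complex representation `ρ` of `G` (written in the basis `b`) with a
homomorphism `α` from `G` to the free abelian group on the `t_i`, here the group of exponent
vectors: `g ↦ t^{α(g)} ρ(g)`. -/
def twist (α : G →* Multiplicative (τ → ℤ)) (ρ : Representation ℂ G V) {n : ℕ}
    (b : Module.Basis (Fin n) ℂ V) : G →* Matrix (Fin n) (Fin n) (RatFun τ) where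
  toFun g := tmonomial (Multiplicative.toAdd (α g)) •
    (LinearMap.toMatrix b b (ρ g)).map (algebraMap ℂ (RatFun τ))
  map_one' := by
    simp [tmonomial, LinearMap.toMatrix_one]
  map_mul' g h := by
    have h1 : tmonomial (Multiplicative.toAdd (α (g * h))) =
        tmonomial (Multiplicative.toAdd (α g)) * tmonomial (Multiplicative.toAdd (α h)) := by
      simp only [tmonomial, ← Finset.prod_mul_distrib, map_mul, toAdd_mul, Pi.add_apply]
      exact Finset.prod_congr rfl fun i _ => zpow_add₀ (tvar_ne_zero i) _ _
    rw [h1, map_mul, LinearMap.toMatrix_mul, Matrix.map_mul, smul_mul_smul_comm]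

/-- The Alexander matrix of a presentation with generators `x_1, …, x_l` and relators
`r_1, …, r_m`: its `(i, j)` block is the `n × n` matrix `Φ(∂r_i/∂x_j)`, where `Φ` is extended
linearly to the group ring `ℤ[F_l]`. -/
def alexanderMatrix {l m n : ℕ} {K : Type*} [Field K]
    (Φ : FreeGroup (Fin l) →* Matrix (Fin n) (Fin n) K) (r : Fin m → FreeGroup (Fin l)) :
    Matrix (Fin m × Fin n) (Fin l × Fin n) K :=
  Matrix.of fun u v => MonoidAlgebra.lift ℤ _ _ Φ (fox v.1 (r u.1)) u.2 v.2

/-- Wada's invariant `det A_j / det Φ(x_j - 1)`, computed from generators `x_1, …, x_{m+1}` (with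
images `gen i` in `G`) and relators `r_1, …, r_m`, where `Φ` is induced by `ρ ⊗ α` and `A_j` is
the Alexander matrix with its `j`th block column removed. -/
def wada (α : G →* Multiplicative (τ → ℤ)) (ρ : Representation ℂ G V) {m n : ℕ}
    (b : Module.Basis (Fin n) ℂ V) (gen : Fin (m + 1) → G)
    (r : Fin m → FreeGroup (Fin (m + 1))) (j : Fin (m + 1)) : RatFun τ :=
  let Φ : FreeGroup (Fin (m + 1)) →* Matrix (Fin n) (Fin n) (RatFun τ) :=
    (twist α ρ b).comp (FreeGroup.lift gen)
  ((alexanderMatrix Φ r).submatrix id (fun v : Fin m × Fin n => (j.succAbove v.1, v.2))).det /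
    (Φ (FreeGroup.of j) - 1).det

end Wada

/-! ### The irreducible representations of `SL(2, ℂ)` -/

section Sym

/-- Substitution `p(z) ↦ p(P⁻¹ z)` in polynomials in two variables. -/
def substInv (P : SL(2, ℂ)) : MvPolynomial (Fin 2) ℂ →ₐ[ℂ] MvPolynomial (Fin 2) ℂ :=
  MvPolynomial.aeval fun i =>
    ∑ k, MvPolynomial.C ((P⁻¹ : SL(2, ℂ)).1 i k) * MvPolynomial.X k

theorem substInv_one : substInv 1 = AlgHom.id ℂ _ := by
  ext i : 1
  fin_cases i <;> simp [substInv, Fin.sum_univ_two]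

theorem substInv_mul (P Q : SL(2, ℂ)) :
    substInv (P * Q) = (substInv P).comp (substInv Q) := by
  ext i : 1
  simp only [substInv, MvPolynomial.aeval_X, AlgHom.comp_apply, map_sum, map_mul, mul_inv_rev,
    Matrix.SpecialLinearGroup.coe_mul, Matrix.mul_apply, MvPolynomial.aeval_C,
    MvPolynomial.algebraMap_eq, Finset.mul_sum, Finset.sum_mul]
  rw [Finset.sum_comm]
  simp only [mul_assoc]

theorem substInv_mem (P : SL(2, ℂ)) (d : ℕ) (p : MvPolynomial (Fin 2) ℂ)
    (hp : p ∈ MvPolynomial.homogeneousSubmodule (Fin 2) ℂ d) :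
    substInv P p ∈ MvPolynomial.homogeneousSubmodule (Fin 2) ℂ d := by
  rw [MvPolynomial.mem_homogeneousSubmodule] at hp ⊢
  have h := hp.aeval (n := 1)
    (fun i => ∑ k, MvPolynomial.C ((P⁻¹ : SL(2, ℂ)).1 i k) * MvPolynomial.X k)
    (fun i => MvPolynomial.IsHomogeneous.sum _ _ _ fun k _ =>
      MvPolynomial.isHomogeneous_C_mul_X _ _)
  simpa [substInv] using h

/-- The space `V_n` of homogeneous polynomials of degree `n - 1` in two variables
(used for `n ≥ 1`). -/
abbrev SymSpace (n : ℕ) : Type := MvPolynomial.homogeneousSubmodule (Fin 2) ℂ (n - 1)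

/-- The representation `σ_n` of `SL(2, ℂ)` on `V_n`, `(P · p)(z) = p(P⁻¹ z)`. -/
def symRep (n : ℕ) : Representation ℂ SL(2, ℂ) (SymSpace n) where
  toFun P := (substInv P).toLinearMap.restrict (substInv_mem P (n - 1))
  map_one' := by
    ext p : 2
    simp [substInv_one]
  map_mul' P Q := by
    ext p : 2
    change substInv (P * Q) p.1 = substInv P (substInv Q p.1)
    rw [substInv_mul, AlgHom.comp_apply]

/-- A representation into `SL(2, ℂ)` is irreducible if `ℂ²` has no nontrivial proper invariant
subspace. -/
def IsIrred {G : Type*} [Group G] (ρ : G →* SL(2, ℂ)) : Prop :=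
  ∀ W : Submodule ℂ (Fin 2 → ℂ), (∀ g, ∀ v ∈ W, (ρ g).1.mulVec v ∈ W) → W = ⊥ ∨ W = ⊤

/-- `M` is conjugate in `SL(2, ℂ)` to `diag(z, z⁻¹)`. -/
def IsConjDiag (M : SL(2, ℂ)) (z : ℂ) : Prop :=
  ∃ C : SL(2, ℂ), (C * M * C⁻¹).1 = !![z, 0; 0, z⁻¹]

end Sym

/-! ### The torus link `T(μp, μq)`

It is given by its standard diagram, the closure of the braid `(σ_1 σ_2 ⋯ σ_{P-1})^Q` with
`P = μp` strands and `Q = μq`, all strands oriented in parallel. The diagram consists of `Q`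
consecutive blocks, labelled cyclically by `k`. At the beginning of block `k` the strands are in
the positions `0, …, P - 1`. In the block the strand in position `0` passes over all the others
and ends in position `P - 1`; for `j = 0, …, P - 2` the strand in position `j + 1` passes under it
and ends in position `j`. -/

section Diagram

variable (μ p q : ℕ)

/-- The strand segments: `(k, i)` is the strand in position `i` at the beginning of block `k`. -/
abbrev Segment : Type := ZMod (μ * q) × Fin (μ * p)

/-- Within block `k`, the strand in position `0` runs over all the others to the last position
without passing under anything. -/
inductive Joined : Segment μ p q → Segment μ p q → Prop
  | over (k : ZMod (μ * q)) (i i' : Fin (μ * p)) (hi : i.val = 0) (hi' : i'.val + 1 = μ * p) :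
      Joined (k, i) (k + 1, i')

/-- The arcs of the diagram: maximal pieces of strands that do not pass under anything. -/
def Arc : Type := Quot (Joined μ p q)

/-- The crossings of the diagram: in the crossing `(k, j)` of block `k`, the strand that starts
in position `0` passes over the one that starts in position `j + 1`. -/
abbrev Crossing : Type := ZMod (μ * q) × Fin (μ * p - 1)

variable {μ p q}

/-- The arc which contains a given segment. -/
def arc (k : ZMod (μ * q)) (i : Fin (μ * p)) : Arc μ p q := Quot.mk _ (k, i)

/-- The overcrossing arc. -/
def overArc (c : Crossing μ p q) : Arc μ p q := arc c.1 ⟨0, by have := c.2.isLt; omega⟩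

/-- The arc that arrives at the crossing from below. -/
def inArc (c : Crossing μ p q) : Arc μ p q :=
  arc c.1 ⟨c.2.val + 1, by have := c.2.isLt; omega⟩

/-- The arc that leaves the crossing from below. -/
def outArc (c : Crossing μ p q) : Arc μ p q :=
  arc (c.1 + 1) ⟨c.2.val, by have := c.2.isLt; omega⟩

/-- The Wirtinger relator `x_over x_in x_over⁻¹ x_out⁻¹` of a crossing. -/
def wirtinger (c : Crossing μ p q) : FreeGroup (Arc μ p q) :=
  FreeGroup.of (overArc c) * FreeGroup.of (inArc c) * (FreeGroup.of (overArc c))⁻¹ *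
    (FreeGroup.of (outArc c))⁻¹

variable (μ p q)

/-- The link group `G(L)` of `L = T(μp, μq)`. -/
abbrev LinkGroup : Type := PresentedGroup (Set.range (wirtinger (μ := μ) (p := p) (q := q)))

variable {μ p q}

/-- The Wirtinger generator (a meridian) of an arc. -/
def meridian (a : Arc μ p q) : LinkGroup μ p q := PresentedGroup.of a

/-- The component of the link to which an arc belongs. The link has `μ` components, labelled by
`ZMod μ`: the sum modulo `μ` of the block and the position does not change along a strand. -/
def component : Arc μ p q → ZMod μ :=
  Quot.lift (fun s => ZMod.castHom (Dvd.intro q rfl) (ZMod μ) s.1 + (s.2.val : ZMod μ)) (by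
    rintro _ _ ⟨k, i, i', hi, hi'⟩
    have h : ((i'.val + 1 : ℕ) : ZMod μ) = 0 := by
      rw [hi', Nat.cast_mul, ZMod.natCast_self, zero_mul]
    push_cast at h
    simp only [hi, map_add, map_one, Nat.cast_zero]
    linear_combination -h)

theorem component_outArc (c : Crossing μ p q) :
    component (outArc c) = component (inArc c) := by
  simp only [component, outArc, inArc, arc, map_add, map_one, Nat.cast_add, Nat.cast_one]
  ring

/-- The abelianization `α_L : G(L) → ⟨t_i⟩ ≅ ℤ^μ`, which sends each meridian to the generator of
its component. -/
def alphaL : LinkGroup μ p q →* Multiplicative (ZMod μ → ℤ) :=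
  PresentedGroup.toGroup
    (f := fun a => Multiplicative.ofAdd (Pi.single (component a) (1 : ℤ))) (by
    rintro _ ⟨c, rfl⟩
    simp [wirtinger, component_outArc])

/-- The element `x`, represented by the core of the solid torus in which the closed braid runs
around `P` times. This core is parallel to the braid strands and lies in the middle of the
rotating strands, so that it passes in each block once below the overcrossing strand and above all
the others; thus `x = m_{Q-1} ⋯ m_1 m_0` for the meridians `m_k` of the overcrossing arcs. -/
def coreX (hp : 0 < μ * p) : LinkGroup μ p q :=
  ((List.range (μ * q)).reverse.map fun k : ℕ => meridian (arc (k : ZMod (μ * q)) ⟨0, hp⟩)).prod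

/-- The element `y`, represented by the core of the complementary solid torus (the axis of the
closed braid), a loop around all the `P` strands at the beginning of block `0`. -/
def coreY : LinkGroup μ p q :=
  (List.ofFn fun i : Fin (μ * p) => meridian (arc (0 : ZMod (μ * q)) i)).prod

/-- The twisted Alexander polynomial of `T(μp, μq)` associated to a representation of the link
group, computed from the Wirtinger presentation `⟨x_1, …, x_{m+1} | r_1, …, r_m⟩`, in which `e`
numbers all arcs and `f` numbers all crossings except one, by removal of the `j`th column. -/
def twistedAlexander {V : Type*} [AddCommGroup V] [Module ℂ V] [NeZero μ]
    (ρ : Representation ℂ (LinkGroup μ p q) V) {n : ℕ} (b : Module.Basis (Fin n) ℂ V) {m : ℕ}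
    (e : Fin (m + 1) ≃ Arc μ p q) (f : Fin m ↪ Crossing μ p q) (j : Fin (m + 1)) :
    RatFun (ZMod μ) :=
  wada alphaL ρ b (fun i => meridian (e i)) (fun i => FreeGroup.map e.symm (wirtinger (f i))) j

end Diagram

/-! ### The right-hand sides -/

section Formula

/-- The product `t = t_1 ⋯ t_μ`. -/
def tprod (μ : ℕ) [NeZero μ] : RatFun (ZMod μ) := ∏ i, tvar i

/-- The factor `u² - 2 cos(θ) u + 1`. -/
def cosFactor {K : Type*} [Field K] [Algebra ℂ K] (u : K) (θ : ℝ) : K :=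
  u ^ 2 - algebraMap ℂ K (2 * (Real.cos θ : ℂ)) * u + 1

end Formula

end TorusLink

end

/-!
The computation is Wada's invariant of a link complement that is Seifert fibred, carried out on the
standard diagram. Write `P = μp`, `Q = μq`, let `Φ = ρ_n ⊗ α_L`, and let `X`, `Y` be the images under
`Φ` of the cores `x`, `y`. A vector of values at the arcs is a derivation on the free group, and the
Alexander matrix evaluates it at the Wirtinger relators; this gives an operator `T` on functions on
the arcs (`Labelling.relations`, `derivation_wirtinger`). The arcs are indexed by position and block,
and each crossing by the arc that emerges from it.

*Choice of row and column.* The operator `T` kills the principal derivations `g ↦ (g - 1) v`, and by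
the identity among the relations that expresses the constancy of the product of the meridians in a
block, a linear map `L` with invertible coefficients satisfies `L ∘ T = 0`. For `k : E → V` and
`l : V → E`, the determinant of `T + k ∘ l` is therefore proportional to `det (L ∘ k)` and to the
determinant of `l` on principal derivations (`det_add_comp_change_left`,
`det_add_comp_change_right`). For unit vectors `k` and coordinates `l` it is a minor of the Alexander
matrix, up to the sign `(±1) ^ n`. So the denominator `det Φ(x_j - 1)` may be exchanged for
`det (X - 1)` when `l` is the value of the derivation at `x`.

*Elimination.* The relations determine the components in all the positions but the first from those
of the overcrossing arcs, with meridians `m_k` (`Labelling.det_relations`). In terms of the values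
`z_k` of the derivation at the products `m_{k-1} ⋯ m_0`, what remains of the relations is that
`z_k - Y z_{k-P}` does not depend on `k ∈ ℤ/Q` (`Labelling.reduced_eq`). This reflects the
presentation of the link group by `Z_{k+P} = y Z_k` and `Z_{k+Q} = Z_k x`. The shift by `P` on `ℤ/Q`
has `μ` cycles of length `q`, so that `z_k ↦ z_k - Y z_{k-P}` has determinant `det (1 - Y ^ q) ^ μ`
(`det_twistedShift`), and the constant that is left over contributes the factor
`det (1 - Y)⁻¹`. Altogether (`exists_det_minor`), up to the indeterminacy,
`Δ = det (Y ^ q - 1) ^ μ / (det (X - 1) det (Y - 1))`.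

*Eigenvalues.* If `M ∈ SL(2, ℂ)` is conjugate to `diag(z, z⁻¹)`, then `σ_n(M)` has the eigenvalues
`z ^ (n - 1 - 2 i)`, and conjugate pairs of them give the factors with the cosines. For the regular
fibre `y ^ q = x ^ p`, `z = (-1) ^ a`. The indeterminacy is no larger than claimed since `σ_n` has
values in `SL(n)`: `SL(2, ℂ)` is perfect.
-/

noncomputable section

namespace TorusLink

/-! ### Determinants of block operators -/

section Determinants

variable {K E V : Type*} [Field K] [AddCommGroup E] [Module K E]
  [AddCommGroup V] [Module K V]

/-- An operator that acts in a single coordinate of `I → E`. -/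
def actAt {I : Type*} [DecidableEq I] (i₀ : I) (A : Module.End K E) :
    (I → E) →ₗ[K] (I → E) :=
  LinearMap.pi fun i => (if i = i₀ then A else 1) ∘ₗ LinearMap.proj i

theorem actAt_same {I : Type*} [DecidableEq I] (i₀ : I) (A : Module.End K E) (w : I → E) :
    actAt i₀ A w i₀ = A (w i₀) := by
  simp [actAt]

theorem actAt_of_ne {I : Type*} [DecidableEq I] {i i₀ : I} (h : i ≠ i₀) (A : Module.End K E)
    (w : I → E) : actAt i₀ A w i = w i := by
  simp [actAt, h]

variable [FiniteDimensional K E] [FiniteDimensional K V]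

/-- An operator on `I → E` that is block triangular for the grading `b`, with the identity in the
diagonal blocks, has determinant one. -/
theorem det_eq_one_of_unitriangular {I α : Type*} [Fintype I] [LinearOrder α] (b : I → α)
    (f : (I → E) →ₗ[K] (I → E))
    (h : ∀ w i, (∀ i', b i' < b i → w i' = 0) → f w i = w i) : LinearMap.det f = 1 := by
  classical
  let B := Pi.basis (fun _ : I => Module.Free.chooseBasis K E)
  have key : ∀ x y, b x.1 ≤ b y.1 →
      LinearMap.toMatrix B B f x y = (1 : Matrix _ _ K) x y := by
    intro x y hxy
    rw [LinearMap.toMatrix_apply]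
    change (Module.Free.chooseBasis K E).repr (f (B y) x.1) x.2 = _
    rw [h]
    · change B.repr (B y) x = _
      rw [B.repr_self, Matrix.one_apply, Finsupp.single_apply]
      simp only [eq_comm]
    · intro i' hi'
      have : i' ≠ y.1 := fun h => absurd hxy (not_le.2 (h ▸ hi'))
      simp [B, Pi.basis_apply, this]
  rw [← LinearMap.det_toMatrix B f]
  have ht : Matrix.BlockTriangular (LinearMap.toMatrix B B f)
      (fun x => OrderDual.toDual (b x.1)) := by
    intro x y hxy
    have hxy : b x.1 < b y.1 := hxy
    rw [key x y hxy.le, Matrix.one_apply_ne]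
    rintro rfl
    exact lt_irrefl _ hxy
  rw [ht.det]
  refine Finset.prod_eq_one fun a _ => ?_
  have : (LinearMap.toMatrix B B f).toSquareBlock (fun x => OrderDual.toDual (b x.1)) a = 1 := by
    ext x y
    have hx := x.2
    have hy := y.2
    rw [Matrix.toSquareBlock_def, Matrix.of_apply, key]
    · simp [Matrix.one_apply, Subtype.ext_iff]
    · exact (OrderDual.toDual.injective (hx.trans hy.symm)).le
  rw [this, Matrix.det_one]

/-- The Weinstein–Aronszajn identity for linear maps. -/
theorem det_one_add_comp_comm (f : E →ₗ[K] V) (g : V →ₗ[K] E) :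
    LinearMap.det (1 + f ∘ₗ g) = LinearMap.det (1 + g ∘ₗ f) := by
  classical
  let b := Module.Free.chooseBasis K E
  let c := Module.Free.chooseBasis K V
  rw [← LinearMap.det_toMatrix c, ← LinearMap.det_toMatrix b, map_add, map_add,
    LinearMap.toMatrix_comp c b c, LinearMap.toMatrix_comp b c b, LinearMap.toMatrix_one,
    LinearMap.toMatrix_one, Matrix.det_one_add_mul_comm]

theorem det_actAt {I : Type*} [Fintype I] [DecidableEq I] (i₀ : I) (A : Module.End K E) :
    LinearMap.det (actAt (K := K) i₀ A) = LinearMap.det A := by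
  rw [actAt, LinearMap.det_pi, Finset.prod_eq_single i₀]
  · simp
  · intro i _ hi
    simp [hi]
  · simp

/-- A permutation of the coordinates of `I → E` has determinant `sign ^ dim E`. -/
theorem det_funLeft_perm {I : Type*} [Fintype I] [DecidableEq I] (τ : Equiv.Perm I) :
    LinearMap.det (LinearMap.funLeft K E τ) =
      (((Equiv.Perm.sign τ : ℤˣ) : ℤ) : K) ^ Module.finrank K E := by
  let b := Module.finBasis K E
  let e : (I → E) ≃ₗ[K] (Fin (Module.finrank K E) → I → K) :=
    (LinearEquiv.piCongrRight fun _ => b.equivFun).trans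
      { Equiv.piComm (fun _ _ => K) with
        map_add' := fun _ _ => rfl
        map_smul' := fun _ _ => rfl }
  rw [← LinearMap.det_conj _ e]
  have : (e.toLinearMap ∘ₗ LinearMap.funLeft K E τ ∘ₗ e.symm.toLinearMap) =
      LinearMap.pi fun i => (LinearMap.funLeft K K τ) ∘ₗ LinearMap.proj i := by
    apply LinearMap.ext
    intro w
    obtain ⟨w, rfl⟩ := e.surjective w
    ext i x
    simp only [LinearMap.comp_apply, LinearEquiv.coe_coe, LinearEquiv.symm_apply_apply]
    rfl
  rw [this, LinearMap.det_pi, Finset.prod_const, Finset.card_univ, Fintype.card_fin]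
  congr 1
  rw [← LinearMap.det_toMatrix', ← Matrix.det_permutation τ]
  congr 1
  ext i j
  simp [LinearMap.toMatrix'_apply, LinearMap.funLeft_apply, Equiv.toPEquiv,
    PEquiv.toMatrix_apply, Pi.single_apply, eq_comm]

theorem det_neg_one_smul (f : Module.End K V) :
    LinearMap.det (-f) = (-1) ^ Module.finrank K V * LinearMap.det f := by
  rw [← LinearMap.det_smul, neg_one_smul]

theorem exists_inverse {A : Module.End K E} (hA : LinearMap.det A ≠ 0) :
    ∃ B : Module.End K E, A ∘ₗ B = 1 ∧ B ∘ₗ A = 1 := by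
  obtain ⟨u, rfl⟩ := (LinearMap.isUnit_iff_isUnit_det A).2 (isUnit_iff_ne_zero.2 hA)
  exact ⟨(u⁻¹ : (Module.End K E)ˣ), u.mul_inv, u.inv_mul⟩

variable {T : Module.End K V} {d : E →ₗ[K] V} {L : V →ₗ[K] E}

/-- If `T ∘ d = 0`, then `det (T + k ∘ l) / det (l ∘ d)` does not depend on `l`. -/
theorem det_add_comp_change_right (hT : T ∘ₗ d = 0) (k : E →ₗ[K] V) (l l' : V →ₗ[K] E)
    (hl : LinearMap.det (l ∘ₗ d) ≠ 0) :
    LinearMap.det (T + k ∘ₗ l') * LinearMap.det (l ∘ₗ d) =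
      LinearMap.det (T + k ∘ₗ l) * LinearMap.det (l' ∘ₗ d) := by
  obtain ⟨B, hB, -⟩ := exists_inverse hl
  have hT' : ∀ v, T (d v) = 0 := fun v => LinearMap.congr_fun hT v
  have hB' : ∀ v, l (d (B v)) = v := fun v => LinearMap.congr_fun hB v
  -- Adding multiples of `d`, which `T` does not see, to the argument turns `l` into `l'`.
  have h1 : T + k ∘ₗ l' = (T + k ∘ₗ l) ∘ₗ (1 + (d ∘ₗ B) ∘ₗ (l' - l)) := by
    ext v
    simp [hT', hB']
  have h2 : (1 : Module.End K E) + (l' - l) ∘ₗ (d ∘ₗ B) = (l' ∘ₗ d) ∘ₗ B := by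
    ext v
    simp [hB']
  have h3 : LinearMap.det B * LinearMap.det (l ∘ₗ d) = 1 := by
    rw [mul_comm, ← LinearMap.det_comp, hB, Module.End.one_eq_id, LinearMap.det_id]
  rw [h1, LinearMap.det_comp, det_one_add_comp_comm, h2, LinearMap.det_comp]
  linear_combination (LinearMap.det (T + k ∘ₗ l) * LinearMap.det (l' ∘ₗ d)) * h3

/-- If `L ∘ T = 0`, then `det (T + k ∘ l) / det (L ∘ k)` does not depend on `k`. -/
theorem det_add_comp_change_left (hT : L ∘ₗ T = 0) (k k' : E →ₗ[K] V) (l : V →ₗ[K] E)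
    (hk : LinearMap.det (L ∘ₗ k) ≠ 0) :
    LinearMap.det (T + k' ∘ₗ l) * LinearMap.det (L ∘ₗ k) =
      LinearMap.det (T + k ∘ₗ l) * LinearMap.det (L ∘ₗ k') := by
  obtain ⟨B, hB, hB2⟩ := exists_inverse hk
  have hT' : ∀ v, L (T v) = 0 := fun v => LinearMap.congr_fun hT v
  have hB' : ∀ v, B (L (k v)) = v := fun v => LinearMap.congr_fun hB2 v
  have h1 : T + k' ∘ₗ l = (1 + (k' - k) ∘ₗ (B ∘ₗ L)) ∘ₗ (T + k ∘ₗ l) := by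
    ext v
    simp [hT', hB']
  have h2 : (1 : Module.End K E) + (B ∘ₗ L) ∘ₗ (k' - k) = B ∘ₗ (L ∘ₗ k') := by
    ext v
    simp [hB']
  have h3 : LinearMap.det B * LinearMap.det (L ∘ₗ k) = 1 := by
    rw [mul_comm, ← LinearMap.det_comp, hB, Module.End.one_eq_id, LinearMap.det_id]
  rw [h1, LinearMap.det_comp, det_one_add_comp_comm, h2, LinearMap.det_comp]
  linear_combination (LinearMap.det (T + k ∘ₗ l) * LinearMap.det (L ∘ₗ k')) * h3

/-- If `T ∘ d = 0`, then the block column of `T + k ∘ l` at the coordinate `l` may be replaced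
by `k`. -/
theorem det_add_comp_eq_replace (hT : T ∘ₗ d = 0) (k i : E →ₗ[K] V) (l : V →ₗ[K] E)
    (hl : LinearMap.det (l ∘ₗ d) ≠ 0) (hi : l ∘ₗ i = 1) :
    LinearMap.det (T + k ∘ₗ l) = LinearMap.det (T ∘ₗ (1 - i ∘ₗ l) + k ∘ₗ l) := by
  obtain ⟨B, hB, -⟩ := exists_inverse hl
  have hT' : ∀ v, T (d v) = 0 := fun v => LinearMap.congr_fun hT v
  have hB' : ∀ v, l (d (B v)) = v := fun v => LinearMap.congr_fun hB v
  have hi' : ∀ v, l (i v) = v := fun v => LinearMap.congr_fun hi v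
  have h1 : T ∘ₗ (1 - i ∘ₗ l) + k ∘ₗ l = (T + k ∘ₗ l) ∘ₗ (1 + (d ∘ₗ B - i) ∘ₗ l) := by
    ext v
    simp [hT', hB', hi']
    abel
  have h2 : (1 : Module.End K E) + l ∘ₗ (d ∘ₗ B - i) = 1 := by
    ext v
    simp [hB', hi']
  rw [h1, LinearMap.det_comp, det_one_add_comp_comm, h2, Module.End.one_eq_id, LinearMap.det_id,
    mul_one]

/-- A block triangular operator on `E × V` with the identity in the first diagonal block. -/
theorem det_prod_triangular (A : Module.End K V) (h : V →ₗ[K] E) (f : Module.End K (E × V))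
    (hf : ∀ x, f x = (x.1 + h x.2, A x.2)) : LinearMap.det f = LinearMap.det A := by
  have h1 : f = LinearMap.prodMap 1 A ∘ₗ
      (1 + LinearMap.inl K E V ∘ₗ (h ∘ₗ LinearMap.snd K E V)) := by
    refine LinearMap.ext fun x => ?_
    rw [hf]
    simp
  have h2 : (1 : Module.End K E) + (h ∘ₗ LinearMap.snd K E V) ∘ₗ LinearMap.inl K E V = 1 := by
    ext
    simp
  rw [h1, LinearMap.det_comp, LinearMap.det_prodMap, det_one_add_comp_comm, h2,
    Module.End.one_eq_id, LinearMap.det_id, one_mul, mul_one]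

theorem det_one_sub (f : Module.End K V) :
    LinearMap.det (1 - f) = (((-1 : ℤˣ) : ℤ) : K) ^ Module.finrank K V * LinearMap.det (f - 1) := by
  rw [← neg_sub, det_neg_one_smul]
  simp

/-- Removing the block column `j` and the block row `j` from an operator on `E ^ (m + 1)`, or
replacing the block column by a unit vector, gives the same determinant. -/
theorem det_minor_eq {m : ℕ} (j : Fin (m + 1)) (M : Module.End K (Fin (m + 1) → E))
    (A : Module.End K (Fin m → E))
    (hA : ∀ w i, A w i = M (j.insertNth (α := fun _ => E) 0 w) (j.succAbove i)) :
    LinearMap.det A = LinearMap.det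
      (M ∘ₗ (1 - LinearMap.single K (fun _ => E) j ∘ₗ LinearMap.proj j) +
        LinearMap.single K (fun _ => E) j ∘ₗ LinearMap.proj j) := by
  let F : (E × (Fin m → E)) ≃ₗ[K] (Fin (m + 1) → E) :=
    { Fin.insertNthEquiv (fun _ => E) j with
      map_add' := fun x y => by
        ext i
        refine Fin.succAboveCases j ?_ (fun i => ?_) i <;> simp [Fin.insertNthEquiv]
      map_smul' := fun a x => by
        ext i
        refine Fin.succAboveCases j ?_ (fun i => ?_) i <;> simp [Fin.insertNthEquiv] }
  have hF : ∀ x, F x = j.insertNth (α := fun _ => E) x.1 x.2 := fun _ => rfl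
  have hF1 : ∀ w, (F.symm w).1 = w j := fun _ => rfl
  have hF2 : ∀ w i, (F.symm w).2 i = w (j.succAbove i) := fun _ _ => rfl
  rw [← LinearMap.det_conj _ F.symm]
  refine (det_prod_triangular A (LinearMap.proj j ∘ₗ M ∘ₗ F.toLinearMap ∘ₗ LinearMap.inr K E _) _
    fun x => ?_).symm
  have h1 : (1 - LinearMap.single K (fun _ => E) j ∘ₗ LinearMap.proj j : Module.End K _) (F x) =
      j.insertNth (α := fun _ => E) 0 x.2 := by
    rw [hF]
    ext i
    refine Fin.succAboveCases j ?_ (fun i => ?_) i <;> simp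
  simp only [LinearMap.comp_apply, LinearEquiv.coe_coe, LinearEquiv.symm_symm,
    LinearMap.add_apply, h1]
  refine Prod.ext ?_ (funext fun i => ?_)
  · rw [hF1]
    simp [hF, add_comm]
  · rw [hF2]
    change _ = A x.2 i
    rw [hA]
    simp

end Determinants

/-! ### Labellings of the standard diagram -/

/-- A labelling by elements of a group `G` of the strand segments of the closure of the braid
`(σ_1 ⋯ σ_{N+1})^Q` with `N + 2` strands, which satisfies the Wirtinger relations: `a k j` is the
label of the strand in position `j` at the beginning of block `k`. Only the labels in the
positions `j < N + 2` matter. -/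
structure Labelling (G : Type*) [Group G] (Q N : ℕ) where
  a : ZMod Q → ℕ → G
  undercross : ∀ k j, j < N + 1 → a (k + 1) j = a k 0 * a k (j + 1) * (a k 0)⁻¹
  overcross : ∀ k, a (k + 1) (N + 1) = a k 0

namespace Labelling

section Words

variable {G : Type*} [Group G] {Q N : ℕ} (c : Labelling G Q N)

theorem label_mul_first (k : ZMod Q) {j : ℕ} (hj : j < N + 1) :
    c.a k j * c.a (k - 1) 0 = c.a (k - 1) 0 * c.a (k - 1) (j + 1) := by
  have := c.undercross (k - 1) j hj
  rw [sub_add_cancel] at this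
  rw [this, inv_mul_cancel_right]

theorem label_last (k : ZMod Q) : c.a k (N + 1) = c.a (k - 1) 0 := by
  have := c.overcross (k - 1)
  rwa [sub_add_cancel] at this

/-- The product `m_{k-1} m_{k-2} ⋯ m_{k-i}` of the labels `m_l` of the overcrossing arcs. -/
def word : ℕ → ZMod Q → G
  | 0, _ => 1
  | i + 1, k => c.a (k - 1) 0 * word i (k - 1)

@[simp] theorem word_zero (k : ZMod Q) : c.word 0 k = 1 := rfl

theorem word_succ (i : ℕ) (k : ZMod Q) :
    c.word (i + 1) k = c.a (k - 1) 0 * c.word i (k - 1) := rfl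

theorem word_add (i j : ℕ) (k : ZMod Q) :
    c.word (i + j) k = c.word i k * c.word j (k - i) := by
  induction i generalizing k with
  | zero => simp
  | succ i ih =>
    rw [Nat.add_right_comm, word_succ, ih, word_succ, mul_assoc]
    congr 3
    push_cast
    ring

theorem label_mul_word (i : ℕ) (hi : i ≤ N + 1) (k : ZMod Q) :
    c.a k (N + 1 - i) * c.word i k = c.word (i + 1) k := by
  induction i generalizing k with
  | zero => simp [word_succ, c.label_last]
  | succ i ih =>
    rw [c.word_succ i, ← mul_assoc, c.label_mul_first k (by omega), mul_assoc,
      show N + 1 - (i + 1) + 1 = N + 1 - i by omega, ih (by omega), ← word_succ]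

theorem word_full_succ (k : ZMod Q) : c.word (N + 2) (k + 1) = c.word (N + 2) k := by
  have := c.label_mul_word (N + 1) le_rfl k
  rw [Nat.sub_self] at this
  rw [word_succ, add_sub_cancel_right, this]

/-- The product of the labels of all the strands does not depend on the block. -/
theorem word_full [NeZero Q] (k : ZMod Q) : c.word (N + 2) k = c.word (N + 2) 0 := by
  have : ∀ i : ℕ, c.word (N + 2) (i : ZMod Q) = c.word (N + 2) 0 := by
    intro i
    induction i with
    | zero => simp
    | succ i ih => rw [Nat.cast_succ, word_full_succ, ih]
  rw [← ZMod.natCast_zmod_val k, this]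

theorem word_period_mul (r : ℕ) : c.word (Q * r) 0 = c.word Q 0 ^ r := by
  induction r with
  | zero => simp
  | succ r ih => rw [Nat.mul_succ, word_add, ih, pow_succ]; simp

theorem word_full_mul [NeZero Q] (r : ℕ) : c.word ((N + 2) * r) 0 = c.word (N + 2) 0 ^ r := by
  induction r with
  | zero => simp
  | succ r ih => rw [Nat.mul_succ, word_add, ih, pow_succ, word_full (k := 0 - _)]

/-- The two cores satisfy `x ^ p = y ^ q`. -/
theorem pow_eq_pow [NeZero Q] {r s : ℕ} (h : Q * r = (N + 2) * s) :
    c.word Q 0 ^ r = c.word (N + 2) 0 ^ s := by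
  rw [← word_period_mul, h, word_full_mul]

/-- The product of the first `j` labels in block `k`. -/
def pre (k : ZMod Q) : ℕ → G
  | 0 => 1
  | j + 1 => pre k j * c.a k j

@[simp] theorem pre_zero (k : ZMod Q) : c.pre k 0 = 1 := rfl

theorem pre_succ (k : ZMod Q) (j : ℕ) : c.pre k (j + 1) = c.pre k j * c.a k j := rfl

theorem pre_mul (k : ZMod Q) (j : ℕ) (hj : j ≤ N + 1) :
    c.pre k j * c.a (k - 1) 0 = c.pre (k - 1) (j + 1) := by
  induction j with
  | zero => simp [pre_succ]
  | succ j ih =>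
    rw [c.pre_succ k, mul_assoc, c.label_mul_first k (by omega), ← mul_assoc, ih (by omega),
      ← c.pre_succ (k - 1)]

theorem pre_mul_word (j : ℕ) (hj : j ≤ N + 2) (k : ZMod Q) :
    c.pre k j * c.word (N + 2 - j) k = c.word (N + 2) k := by
  induction j with
  | zero => simp
  | succ j ih =>
    have := c.label_mul_word (N + 1 - j) (by omega) k
    rw [show N + 1 - (N + 1 - j) = j by omega, show N + 1 - j + 1 = N + 2 - j by omega] at this
    rw [pre_succ, mul_assoc, show N + 2 - (j + 1) = N + 1 - j by omega, this, ih (by omega)]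

theorem pre_full (k : ZMod Q) : c.pre k (N + 2) = c.word (N + 2) k := by
  rw [← c.pre_mul_word (N + 2) le_rfl k]
  simp

end Words

/-! ### The linearized Wirtinger relations -/

section Relations

variable {K G E : Type*} [Field K] [Group G] [AddCommGroup E] [Module K E]
variable {Q N : ℕ} (c : Labelling G Q N) (φ : Representation K G E)

theorem rep_mul_apply (g h : G) (v : E) : φ g (φ h v) = φ (g * h) v := by
  rw [map_mul, Module.End.mul_apply]

/-- The component of `w` at the strand in position `j` of block `k`. The `N + 1` independent
components of a block belong to the positions `j ≤ N`; the strand that arrives in position `N + 1`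
is the overcrossing strand of the block before. -/
def entry (j : ℕ) (k : ZMod Q) : (Fin (N + 1) → ZMod Q → E) →ₗ[K] E :=
  if h : j < N + 1 then LinearMap.proj k ∘ₗ LinearMap.proj ⟨j, h⟩
  else LinearMap.proj (k - 1) ∘ₗ LinearMap.proj 0

theorem entry_of_lt {j : ℕ} (h : j < N + 1) (k : ZMod Q) (w : Fin (N + 1) → ZMod Q → E) :
    entry (K := K) j k w = w ⟨j, h⟩ k := by
  simp [entry, h]

theorem entry_of_not_lt {j : ℕ} (h : ¬ j < N + 1) (k : ZMod Q) (w : Fin (N + 1) → ZMod Q → E) :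
    entry (K := K) j k w = w 0 (k - 1) := by
  simp [entry, h]

/-- The linearization of the Wirtinger relation at the crossing of block `k - 1` from which the
strand in position `j` of block `k` emerges. -/
def row (j : ℕ) (k : ZMod Q) : (Fin (N + 1) → ZMod Q → E) →ₗ[K] E :=
  (1 - φ (c.a k j)) ∘ₗ entry 0 (k - 1) + φ (c.a (k - 1) 0) ∘ₗ entry (j + 1) (k - 1) - entry j k

theorem row_apply (j : ℕ) (k : ZMod Q) (w : Fin (N + 1) → ZMod Q → E) :
    c.row φ j k w = w 0 (k - 1) - φ (c.a k j) (w 0 (k - 1)) +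
      φ (c.a (k - 1) 0) (entry (K := K) (j + 1) (k - 1) w) - entry (K := K) j k w := by
  simp [row, entry_of_lt]

/-- All the linearized Wirtinger relations; a relation is indexed by the strand that emerges from
its crossing. -/
def relations : Module.End K (Fin (N + 1) → ZMod Q → E) :=
  LinearMap.pi fun j => LinearMap.pi fun k => c.row φ j k

theorem relations_apply (w : Fin (N + 1) → ZMod Q → E) (j : Fin (N + 1)) (k : ZMod Q) :
    c.relations φ w j k = c.row φ j k w := rfl

/-- The values `(g - 1) v` of the principal derivation at the labels. -/
def principal : E →ₗ[K] (Fin (N + 1) → ZMod Q → E) :=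
  LinearMap.pi fun j => LinearMap.pi fun k => φ (c.a k j) - 1

theorem principal_apply (v : E) (j : Fin (N + 1)) (k : ZMod Q) :
    c.principal φ v j k = φ (c.a k j) v - v := rfl

theorem entry_principal {j : ℕ} (hj : j ≤ N + 1) (k : ZMod Q) (v : E) :
    entry (K := K) j k (c.principal φ v) = φ (c.a k j) v - v := by
  by_cases h : j < N + 1
  · rw [entry_of_lt h, principal_apply]
  · obtain rfl : j = N + 1 := by omega
    rw [entry_of_not_lt h, principal_apply, c.label_last]
    rfl

theorem relations_comp_principal : c.relations φ ∘ₗ c.principal φ = 0 := by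
  ext v j k
  have h := j.isLt
  simp only [LinearMap.comp_apply, relations_apply, row_apply, LinearMap.zero_apply,
    Pi.zero_apply]
  rw [entry_principal _ _ (by omega), entry_principal _ _ (by omega), principal_apply]
  simp only [map_sub, rep_mul_apply, Fin.val_zero, c.label_mul_first k h]
  abel

/-- The terms of the overcrossing strand telescope. -/
theorem sum_row (w : Fin (N + 1) → ZMod Q → E) (k : ZMod Q) (J : ℕ) (hJ : J ≤ N + 1) :
    ∑ j ∈ Finset.range J, φ (c.pre k j) (c.row φ j k w) =
      w 0 (k - 1) - φ (c.pre k J) (w 0 (k - 1)) +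
        ∑ j ∈ Finset.range J, φ (c.pre (k - 1) (j + 1)) (entry (K := K) (j + 1) (k - 1) w) -
        ∑ j ∈ Finset.range J, φ (c.pre k j) (entry (K := K) j k w) := by
  induction J with
  | zero => simp
  | succ J ih =>
    simp only [Finset.sum_range_succ]
    rw [ih (by omega), row_apply]
    simp only [map_sub, map_add, rep_mul_apply]
    rw [c.pre_mul k J (by omega), c.pre_succ k J]
    abel

theorem sum_row_full (w : Fin (N + 1) → ZMod Q → E) (k : ZMod Q) :
    ∑ j : Fin (N + 1), φ (c.pre k j) (c.row φ j k w) =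
      ∑ j ∈ Finset.range (N + 2), φ (c.pre (k - 1) j) (entry (K := K) j (k - 1) w) -
      ∑ j ∈ Finset.range (N + 2), φ (c.pre k j) (entry (K := K) j k w) := by
  rw [Fin.sum_univ_eq_sum_range (fun j => φ (c.pre k j) (c.row φ j k w)),
    c.sum_row φ w k (N + 1) le_rfl, Finset.sum_range_succ' _ (N + 1), Finset.sum_range_succ _ (N + 1),
    entry_of_not_lt (lt_irrefl _), entry_of_lt (Nat.succ_pos N)]
  simp only [pre_zero, map_one, Module.End.one_apply, Fin.zero_eta]
  abel

variable [NeZero Q]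

/-- The linearization of the identity among the relations which says that the product of the
labels in a block does not change when one runs through all the blocks. -/
def identity : (Fin (N + 1) → ZMod Q → E) →ₗ[K] E :=
  ∑ k, ∑ j : Fin (N + 1), φ (c.pre k j) ∘ₗ LinearMap.proj k ∘ₗ LinearMap.proj j

theorem identity_apply (z : Fin (N + 1) → ZMod Q → E) :
    c.identity φ z = ∑ k, ∑ j : Fin (N + 1), φ (c.pre k j) (z j k) := by
  simp [identity]

theorem identity_comp_relations : c.identity φ ∘ₗ c.relations φ = 0 := by
  refine LinearMap.ext fun w => ?_
  rw [LinearMap.comp_apply, identity_apply]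
  simp only [relations_apply, sum_row_full, LinearMap.zero_apply]
  rw [Finset.sum_sub_distrib, sub_eq_zero]
  exact (Equiv.subRight (1 : ZMod Q)).sum_comp
    fun k => ∑ j ∈ Finset.range (N + 2), φ (c.pre k j) (entry (K := K) j k w)

/-- The inclusion of `E` as the component at position `j` of block `k`. -/
def incl (j : Fin (N + 1)) (k : ZMod Q) : E →ₗ[K] (Fin (N + 1) → ZMod Q → E) :=
  LinearMap.single K (fun _ : Fin (N + 1) => ZMod Q → E) j ∘ₗ LinearMap.single K (fun _ => E) k

theorem identity_comp_incl (j : Fin (N + 1)) (k : ZMod Q) :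
    c.identity φ ∘ₗ incl j k = φ (c.pre k j) := by
  ext v
  rw [LinearMap.comp_apply, identity_apply, Finset.sum_eq_single k, Finset.sum_eq_single j]
  · simp [incl]
  · intro j' _ hj'
    simp [incl, hj']
  · simp
  · intro k' _ hk'
    refine Finset.sum_eq_zero fun j' _ => ?_
    by_cases h : j' = j
    · subst h
      simp [incl, hk']
    · simp [incl, h]
  · simp

end Relations

/-! ### Elimination of the positions other than the first -/

section Elimination

variable {K G E : Type*} [Field K] [Group G] [AddCommGroup E] [Module K E]
variable {Q N : ℕ} (c : Labelling G Q N) (φ : Representation K G E)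

/-- The component at position `N + 1 - i` which the linearized relations determine from the
components `u` at position `0`. -/
def elim : ℕ → (ZMod Q → E) →ₗ[K] (ZMod Q → E)
  | 0 => LinearMap.pi fun k => LinearMap.proj (k - 1)
  | i + 1 => LinearMap.pi fun k => (1 - φ (c.a k (N - i))) ∘ₗ LinearMap.proj (k - 1) +
      φ (c.a (k - 1) 0) ∘ₗ LinearMap.proj (k - 1) ∘ₗ elim i

theorem elim_zero (u : ZMod Q → E) (k : ZMod Q) : c.elim φ 0 u k = u (k - 1) := rfl

theorem elim_succ (i : ℕ) (u : ZMod Q → E) (k : ZMod Q) :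
    c.elim φ (i + 1) u k = u (k - 1) - φ (c.a k (N - i)) (u (k - 1)) +
      φ (c.a (k - 1) 0) (c.elim φ i u (k - 1)) := rfl

/-- The relations that remain when only the components at position `0` are kept. -/
def reduced : Module.End K (ZMod Q → E) := c.elim φ (N + 1) - 1

/-- The substitution of the solution of the eliminated relations. -/
def substitution : Module.End K (Fin (N + 1) → ZMod Q → E) :=
  LinearMap.pi fun j => LinearMap.proj j +
    (if j = 0 then (0 : Module.End K (ZMod Q → E)) else c.elim φ (N + 1 - j)) ∘ₗ
      LinearMap.proj (φ := fun _ : Fin (N + 1) => ZMod Q → E) 0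

theorem substitution_zero (w : Fin (N + 1) → ZMod Q → E) : c.substitution φ w 0 = w 0 := by
  simp [substitution]

theorem substitution_of_ne (w : Fin (N + 1) → ZMod Q → E) {j : Fin (N + 1)} (h : j ≠ 0) :
    c.substitution φ w j = w j + c.elim φ (N + 1 - j) (w 0) := by
  simp [substitution, h]

/-- The part of the eliminated relations above the diagonal. -/
def shear : Module.End K (Fin (N + 1) → ZMod Q → E) :=
  LinearMap.pi fun j => LinearMap.pi fun k =>
    entry j k - φ (c.a (k - 1) 0) ∘ₗ
      (if (j : ℕ) + 1 < N + 1 then entry (j + 1) (k - 1) else 0)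

theorem shear_apply (w : Fin (N + 1) → ZMod Q → E) (j : Fin (N + 1)) (k : ZMod Q) :
    c.shear φ w j k = w j k - φ (c.a (k - 1) 0)
      (if (j : ℕ) + 1 < N + 1 then entry (K := K) (j + 1) (k - 1) w else 0) := by
  simp only [shear, LinearMap.pi_apply, LinearMap.sub_apply, entry_of_lt j.isLt]
  split_ifs <;> simp

theorem entry_substitution (w : Fin (N + 1) → ZMod Q → E) {j : ℕ} (hj : j ≤ N) (k : ZMod Q) :
    entry (K := K) (j + 1) k (c.substitution φ w) =
      (if j + 1 < N + 1 then entry (K := K) (j + 1) k w else 0) + c.elim φ (N - j) (w 0) k := by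
  split_ifs with h
  · rw [entry_of_lt h, entry_of_lt h, substitution_of_ne _ _ _ (Fin.ne_of_val_ne (Nat.succ_ne_zero _)),
      Pi.add_apply]
    change _ + c.elim φ (N + 1 - (j + 1)) (w 0) k = _
    rw [Nat.add_sub_add_right]
  · obtain rfl : j = N := by omega
    rw [entry_of_not_lt h, substitution_zero, Nat.sub_self, elim_zero, zero_add]

/-- The block diagonal operator with block `A` at position `0` and `-1` elsewhere. -/
def blocks (A : Module.End K (ZMod Q → E)) : Module.End K (Fin (N + 1) → ZMod Q → E) :=
  LinearMap.pi fun j => (if j = 0 then A else -1) ∘ₗ LinearMap.proj j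

theorem blocks_zero (A : Module.End K (ZMod Q → E)) (w : Fin (N + 1) → ZMod Q → E) :
    blocks A w 0 = A (w 0) := by
  simp [blocks]

theorem blocks_of_ne (A : Module.End K (ZMod Q → E)) (w : Fin (N + 1) → ZMod Q → E)
    {j : Fin (N + 1)} (h : j ≠ 0) : blocks A w j = - w j := by
  simp [blocks, h]

/-- After the substitution the relations are block triangular: those at the positions other than
the first have diagonal blocks `-1`, and those at the first position become the reduced ones. -/
theorem relations_comp_substitution (k : E →ₗ[K] (ZMod Q → E)) (l : (ZMod Q → E) →ₗ[K] E) :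
    (c.relations φ + (LinearMap.single K (fun _ : Fin (N + 1) => ZMod Q → E) 0 ∘ₗ k) ∘ₗ
      (l ∘ₗ LinearMap.proj 0)) ∘ₗ c.substitution φ =
    c.shear φ ∘ₗ blocks (c.reduced φ + k ∘ₗ l) := by
  refine LinearMap.ext fun w => ?_
  ext j i
  have hj := j.isLt
  simp only [LinearMap.comp_apply, LinearMap.add_apply, Pi.add_apply, relations_apply, row_apply,
    LinearMap.proj_apply, substitution_zero, shear_apply]
  rw [entry_substitution _ _ _ (by omega), entry_of_lt hj, Fin.eta]
  have hb : (if (j : ℕ) + 1 < N + 1 then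
      entry (K := K) (j + 1) (i - 1) (blocks (c.reduced φ + k ∘ₗ l) w) else 0) =
      - (if (j : ℕ) + 1 < N + 1 then entry (K := K) (j + 1) (i - 1) w else 0) := by
    split_ifs with h
    · rw [entry_of_lt h, entry_of_lt h, blocks_of_ne _ _ (Fin.ne_of_val_ne (Nat.succ_ne_zero _)),
        Pi.neg_apply]
    · simp
  rw [hb]
  by_cases h : j = 0
  · subst h
    simp only [substitution_zero, blocks_zero, LinearMap.add_apply, reduced,
      LinearMap.sub_apply, Pi.add_apply, Pi.sub_apply, elim_succ, Fin.val_zero, Nat.sub_zero,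
      Nat.sub_self, Module.End.one_apply, map_add, map_neg, LinearMap.comp_apply,
      LinearMap.coe_single, Pi.single_eq_same]
    abel
  · have hj0 : (j : ℕ) ≠ 0 := fun h' => h (Fin.ext h')
    obtain ⟨r, hr⟩ : ∃ r, N - (j : ℕ) = r := ⟨_, rfl⟩
    simp only [substitution_of_ne _ _ _ h, blocks_of_ne _ _ h, Pi.add_apply,
      show N + 1 - (j : ℕ) = r + 1 by omega, elim_succ, hr, show N - r = (j : ℕ) by omega,
      LinearMap.coe_single, Pi.single_eq_of_ne h, Pi.zero_apply, Pi.neg_apply, map_add, map_neg]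
    abel

variable [NeZero Q] [FiniteDimensional K E]

theorem det_substitution : LinearMap.det (c.substitution φ) = 1 := by
  refine det_eq_one_of_unitriangular (id : Fin (N + 1) → _) _ fun w j hw => ?_
  by_cases h : j = 0
  · rw [h, substitution_zero]
  · rw [substitution_of_ne _ _ _ h, hw 0 (Fin.pos_iff_ne_zero.2 h), map_zero, add_zero]

theorem det_shear : LinearMap.det (c.shear φ) = 1 := by
  refine det_eq_one_of_unitriangular (OrderDual.toDual : Fin (N + 1) → _) _ fun w j hw => ?_
  ext k
  rw [shear_apply]
  split_ifs with h
  · rw [entry_of_lt h, hw ⟨j + 1, h⟩ (OrderDual.toDual_lt_toDual.2 (Fin.lt_def.2 (by simp)))]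
    simp
  · simp

theorem det_blocks (A : Module.End K (ZMod Q → E)) :
    LinearMap.det (blocks (N := N) A) =
      ((-1) ^ (N * Q)) ^ Module.finrank K E * LinearMap.det A := by
  rw [blocks, LinearMap.det_pi, Fin.prod_univ_succ]
  simp only [if_true, Fin.succ_ne_zero, if_false, Finset.prod_const, Finset.card_univ,
    Fintype.card_fin]
  rw [det_neg_one_smul, Module.finrank_pi_fintype, Module.End.one_eq_id, LinearMap.det_id]
  simp only [Finset.sum_const, Finset.card_univ, ZMod.card, smul_eq_mul]
  rw [mul_one, mul_comm]
  congr 1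
  rw [← pow_mul, ← pow_mul]
  congr 1
  ring

/-- The elimination for the determinant of the relations, with an additional entry `k ∘ l` that
only involves the first position. -/
theorem det_relations (k : E →ₗ[K] (ZMod Q → E)) (l : (ZMod Q → E) →ₗ[K] E) :
    LinearMap.det (c.relations φ + (LinearMap.single K (fun _ : Fin (N + 1) => ZMod Q → E) 0 ∘ₗ k)
      ∘ₗ (l ∘ₗ LinearMap.proj 0)) =
    ((-1) ^ (N * Q)) ^ Module.finrank K E * LinearMap.det (c.reduced φ + k ∘ₗ l) := by
  have h := congrArg LinearMap.det (c.relations_comp_substitution φ k l)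
  rwa [LinearMap.det_comp, LinearMap.det_comp, det_substitution, det_shear, mul_one, one_mul,
    det_blocks] at h

end Elimination

end Labelling

/-! ### Operators on functions on a cycle -/

section Cycle

variable {K E : Type*} [Field K] [AddCommGroup E] [Module K E] {Q : ℕ}

theorem val_sub_one_add_one [NeZero Q] {k : ZMod Q} (hk : k ≠ 0) :
    (k - 1).val + 1 = k.val := by
  have h0 : 0 < k.val := Nat.pos_of_ne_zero fun h => hk ((ZMod.val_eq_zero k).1 h)
  have h1 : k - 1 = ((k.val - 1 : ℕ) : ZMod Q) := by
    rw [Nat.cast_sub h0, ZMod.natCast_zmod_val, Nat.cast_one]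
  rw [h1, ZMod.val_natCast, Nat.mod_eq_of_lt (by have := ZMod.val_lt k; omega)]
  omega

theorem val_zero_sub_one_add_one [NeZero Q] : ((0 : ZMod Q) - 1).val + 1 = Q := by
  obtain ⟨n, rfl⟩ := Nat.exists_eq_succ_of_ne_zero (NeZero.ne Q)
  rw [zero_sub, ZMod.val_neg_one]

variable (K E Q) in
/-- Replacement of the value at `0` by zero. -/
def cut : Module.End K (ZMod Q → E) :=
  1 - LinearMap.single K (fun _ => E) 0 ∘ₗ LinearMap.proj 0

@[simp] theorem cut_zero (z : ZMod Q → E) : cut K E Q z 0 = 0 := by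
  simp [cut]

theorem cut_of_ne (z : ZMod Q → E) {k : ZMod Q} (h : k ≠ 0) : cut K E Q z k = z k := by
  simp [cut, h]

theorem cut_congr {z z' : ZMod Q → E} (h : ∀ k, k ≠ 0 → z k = z' k) :
    cut K E Q z = cut K E Q z' := by
  ext k
  by_cases hk : k = 0
  · simp [hk]
  · rw [cut_of_ne _ hk, cut_of_ne _ hk, h k hk]

/-- The operator `z_k ↦ z_k - M_k z_{k-1}`, where `z_0` is omitted in the second term. -/
def subdiagonal (M : ZMod Q → Module.End K E) : Module.End K (ZMod Q → E) :=
  1 - LinearMap.pi fun k => M k ∘ₗ LinearMap.proj (k - 1) ∘ₗ cut K E Q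

theorem subdiagonal_apply (M : ZMod Q → Module.End K E) (z : ZMod Q → E) (k : ZMod Q) :
    subdiagonal M z k = z k - M k (cut K E Q z (k - 1)) := rfl

/-- The operator `z_k ↦ z_k - Y z_{k-s}`. -/
def twistedShift (Y : Module.End K E) (s : ZMod Q) : Module.End K (ZMod Q → E) :=
  1 - LinearMap.pi fun k => Y ∘ₗ LinearMap.proj (k - s)

theorem twistedShift_apply (Y : Module.End K E) (s : ZMod Q) (z : ZMod Q → E) (k : ZMod Q) :
    twistedShift Y s z k = z k - Y (z (k - s)) := rfl

variable (K E Q) in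
/-- The operator `z_k ↦ z_k - z_{k+1}`. -/
def difference : Module.End K (ZMod Q → E) :=
  1 - LinearMap.funLeft K E fun k => k + 1

theorem difference_apply (z : ZMod Q → E) (k : ZMod Q) :
    difference K E Q z k = z k - z (k + 1) := rfl

/-- The operator that replaces `z_0` by zero and then adds a linear function of `z_0` to each
component. -/
def spread (f : ZMod Q → Module.End K E) : Module.End K (ZMod Q → E) :=
  cut K E Q + LinearMap.pi fun k => f k ∘ₗ LinearMap.proj 0

theorem spread_apply (f : ZMod Q → Module.End K E) (z : ZMod Q → E) (k : ZMod Q) :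
    spread f z k = cut K E Q z k + f k (z 0) := rfl

variable [NeZero Q] [FiniteDimensional K E]

theorem det_subdiagonal (M : ZMod Q → Module.End K E) : LinearMap.det (subdiagonal M) = 1 := by
  -- The cycle is cut open at `0`, which becomes the last index.
  refine det_eq_one_of_unitriangular (fun k : ZMod Q => (k - 1).val) _ fun z k hz => ?_
  rw [subdiagonal_apply]
  by_cases h : k - 1 = 0
  · simp [h]
  · rw [cut_of_ne _ h, hz (k - 1) (by have := val_sub_one_add_one h; omega), map_zero, sub_zero]

theorem det_spread {f : ZMod Q → Module.End K E} (hf : f 0 = 1) :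
    LinearMap.det (spread f) = 1 := by
  refine det_eq_one_of_unitriangular (fun k : ZMod Q => if k = 0 then 0 else 1) _
    fun z k hz => ?_
  rw [spread_apply]
  by_cases h : k = 0
  · simp [h, hf]
  · rw [cut_of_ne _ h, hz 0 (by simp [h]), map_zero, add_zero]

theorem det_difference_add :
    LinearMap.det (difference K E Q + LinearMap.single K (fun _ => E) 0 ∘ₗ LinearMap.proj 0) =
      1 := by
  have h : LinearMap.det
      ((difference K E Q + LinearMap.single K (fun _ => E) 0 ∘ₗ LinearMap.proj 0) ∘ₗ
        spread fun _ => 1) = 1 := by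
    refine det_eq_one_of_unitriangular (fun k : ZMod Q => OrderDual.toDual k.val) _
      fun z k hz => ?_
    have h1 : cut K E Q z (k + 1) = 0 := by
      by_cases h : k + 1 = 0
      · simp [h]
      · rw [cut_of_ne _ h, hz]
        have := val_sub_one_add_one h
        rw [add_sub_cancel_right] at this
        exact OrderDual.toDual_lt_toDual.2 (by omega)
    simp only [LinearMap.comp_apply, LinearMap.add_apply, Pi.add_apply, difference_apply,
      spread_apply, h1, LinearMap.proj_apply, cut_zero, LinearMap.coe_single]
    by_cases h : k = 0
    · simp [h]
    · simp [h, cut_of_ne]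
  rwa [LinearMap.det_comp, det_spread rfl, mul_one] at h

/-- The determinant of `z_k ↦ z_k - Y z_{k-1}` on a cycle of length `Q` is `det (1 - Y ^ Q)`. -/
theorem det_twistedShift_one (Y : Module.End K E) :
    LinearMap.det (twistedShift Y (1 : ZMod Q)) = LinearMap.det (1 - Y ^ Q) := by
  have h : twistedShift Y (1 : ZMod Q) ∘ₗ spread (fun k => Y ^ k.val) =
      subdiagonal (fun _ => Y) ∘ₗ actAt 0 (1 - Y ^ Q) := by
    refine LinearMap.ext fun z => funext fun k => ?_
    simp only [LinearMap.comp_apply, twistedShift_apply, spread_apply, subdiagonal_apply]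
    rw [cut_congr (z := actAt 0 (1 - Y ^ Q) z) (z' := z) fun k hk => actAt_of_ne hk _ _, map_add,
      ← Module.End.mul_apply Y, ← pow_succ']
    by_cases hk : k = 0
    · rw [hk, val_zero_sub_one_add_one, actAt_same]
      simp
      abel
    · rw [val_sub_one_add_one hk, actAt_of_ne hk, cut_of_ne z hk]
      abel
  have h2 := congrArg LinearMap.det h
  rwa [LinearMap.det_comp, LinearMap.det_comp, det_spread (by simp), det_subdiagonal, det_actAt,
    mul_one, one_mul] at h2

/-- The shift by `μ p` on `ℤ/μq` has `μ` cycles, of length `q`. -/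
theorem exists_cycle_equiv (μ p q : ℕ) [NeZero μ] [NeZero q] (hpq : Nat.Coprime p q) :
    ∃ e : Fin μ × ZMod q ≃ ZMod (μ * q),
      ∀ r s, e (r, s - 1) = e (r, s) - ((μ * p : ℕ) : ZMod (μ * q)) := by
  let g : Fin μ × ZMod q → ZMod (μ * q) := fun x =>
    ((x.1.val + μ * p * x.2.val : ℕ) : ZMod (μ * q))
  have hmul : ∀ i j : ℕ, i ≡ j [MOD q] →
      ((μ * p * i : ℕ) : ZMod (μ * q)) = ((μ * p * j : ℕ) : ZMod (μ * q)) := by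
    intro i j h
    rw [ZMod.natCast_eq_natCast_iff, mul_assoc, mul_assoc]
    exact (h.mul_left p).mul_left' μ
  have hinj : Function.Injective g := by
    rintro ⟨r, s⟩ ⟨r', s'⟩ h
    have h1 := (ZMod.natCast_eq_natCast_iff _ _ _).1 h
    have h2 : r = r' := by
      have h3 := h1.of_mul_right q
      simp only [Nat.ModEq, mul_assoc, Nat.add_mul_mod_self_left] at h3
      rw [Nat.mod_eq_of_lt r.isLt, Nat.mod_eq_of_lt r'.isLt] at h3
      exact Fin.ext h3
    subst h2
    have h4 := Nat.ModEq.add_left_cancel' _ h1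
    simp only [mul_assoc] at h4
    have h5 := (Nat.ModEq.mul_left_cancel_iff' (NeZero.ne μ)).1 h4
    have h6 := Nat.ModEq.cancel_left_of_coprime (hpq.symm : Nat.gcd q p = 1) h5
    rw [Prod.mk.injEq]
    refine ⟨rfl, ?_⟩
    have h7 := (ZMod.natCast_eq_natCast_iff s.val s'.val q).2 h6
    rwa [ZMod.natCast_zmod_val, ZMod.natCast_zmod_val] at h7
  have hbij : Function.Bijective g :=
    (Fintype.bijective_iff_injective_and_card g).2 ⟨hinj, by simp [ZMod.card]⟩
  refine ⟨Equiv.ofBijective g hbij, fun r s => ?_⟩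
  change g (r, s - 1) = g (r, s) - _
  rw [eq_sub_iff_add_eq]
  simp only [g]
  have := hmul ((s - 1).val + 1) s.val ((ZMod.natCast_eq_natCast_iff _ _ q).1 (by simp))
  rw [Nat.cast_add, Nat.cast_add (r : ℕ), ← this]
  push_cast
  ring

/-- On `ℤ/μq` the shift by `μ p` decomposes into `μ` cycles of length `q`. -/
theorem det_twistedShift (μ p q : ℕ) [NeZero μ] [NeZero q] (hpq : Nat.Coprime p q)
    (Y : Module.End K E) :
    LinearMap.det (twistedShift Y ((μ * p : ℕ) : ZMod (μ * q))) =
      LinearMap.det (1 - Y ^ q) ^ μ := by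
  obtain ⟨e, he⟩ := exists_cycle_equiv μ p q hpq
  let F : (ZMod (μ * q) → E) ≃ₗ[K] (Fin μ → ZMod q → E) :=
    (LinearEquiv.funCongrLeft K E e).trans (LinearEquiv.curry K E (Fin μ) (ZMod q))
  have hF : ∀ z r s, F z r s = z (e (r, s)) := fun _ _ _ => rfl
  have h : F.toLinearMap ∘ₗ twistedShift Y ((μ * p : ℕ) : ZMod (μ * q)) ∘ₗ F.symm.toLinearMap =
      LinearMap.pi fun r => twistedShift Y 1 ∘ₗ LinearMap.proj r := by
    refine LinearMap.ext fun w => ?_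
    obtain ⟨z, rfl⟩ := F.surjective w
    ext r s
    simp only [LinearMap.comp_apply, LinearEquiv.coe_coe, LinearEquiv.symm_apply_apply, hF,
      LinearMap.pi_apply, twistedShift_apply, LinearMap.proj_apply, he]
  rw [← LinearMap.det_conj _ F, h, LinearMap.det_pi, Finset.prod_const, Finset.card_univ,
    Fintype.card_fin, det_twistedShift_one]

/-- With the variable at `0` replaced by a common constant of all the rows, `det (1 - Y)` is divided
out of the determinant of the shift operator: constant functions are mapped to constant functions,
by `1 - Y`. -/
theorem det_difference_comp (Y : Module.End K E) (s : ZMod Q) (hY : LinearMap.det (1 - Y) ≠ 0) :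
    LinearMap.det (difference K E Q ∘ₗ twistedShift Y s ∘ₗ cut K E Q +
      LinearMap.single K (fun _ => E) 0 ∘ₗ LinearMap.proj 0) * LinearMap.det (1 - Y) =
      LinearMap.det (twistedShift Y s) := by
  obtain ⟨B, hB, -⟩ := exists_inverse hY
  have hB' : ∀ v, B v - Y (B v) = v := fun v => LinearMap.congr_fun hB v
  -- `J` adds the value at `0` of the shifted function to `z_0`, to match `difference + z_0`, which
  -- sees that value as well.
  let J : Module.End K (ZMod Q → E) :=
    1 + (LinearMap.single K (fun _ => E) 0 ∘ₗ LinearMap.proj 0) ∘ₗ twistedShift Y s ∘ₗ cut K E Q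
  have hJ0 : ∀ z, J z 0 = z 0 + twistedShift Y s (cut K E Q z) 0 := fun z => by
    simp [J]
  have hJ : ∀ z k, k ≠ 0 → J z k = z k := fun z k hk => by
    simp [J, hk]
  have hJdet : LinearMap.det J = 1 := by
    refine det_eq_one_of_unitriangular (fun k : ZMod Q => if k = 0 then 1 else 0) _
      fun z k hz => ?_
    by_cases h : k = 0
    · subst h
      have : cut K E Q z = 0 := by
        rw [← map_zero (cut K E Q)]
        exact cut_congr fun k hk => hz k (by simp [hk])
      rw [hJ0, this]
      simp
    · exact hJ z k h
  have h : (difference K E Q ∘ₗ twistedShift Y s ∘ₗ cut K E Q +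
      LinearMap.single K (fun _ => E) 0 ∘ₗ LinearMap.proj 0) ∘ₗ J =
      (difference K E Q + LinearMap.single K (fun _ => E) 0 ∘ₗ LinearMap.proj 0) ∘ₗ
        twistedShift Y s ∘ₗ spread (fun _ => 1) ∘ₗ actAt 0 B := by
    refine LinearMap.ext fun z => funext fun k => ?_
    have h1 : twistedShift Y s (spread (K := K) (fun _ => 1) (actAt 0 B z)) =
        twistedShift Y s (cut K E Q z) + fun _ => z 0 := by
      funext k
      rw [Pi.add_apply, twistedShift_apply, twistedShift_apply, spread_apply, spread_apply,
        cut_congr (z := actAt 0 B z) (z' := z) fun k hk => actAt_of_ne hk _ _, actAt_same,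
        Module.End.one_apply, map_add]
      have h5 := hB' (z 0)
      generalize B (z 0) = v at h5 ⊢
      rw [← h5]
      abel
    simp only [LinearMap.comp_apply, LinearMap.add_apply, Pi.add_apply, h1, difference_apply,
      LinearMap.proj_apply, hJ0, cut_congr (hJ z)]
    rw [add_comm (z 0)]
    abel
  have h2 := congrArg LinearMap.det h
  rw [LinearMap.det_comp, LinearMap.det_comp, LinearMap.det_comp, LinearMap.det_comp, hJdet,
    det_difference_add, det_spread rfl, det_actAt, mul_one, one_mul, one_mul] at h2
  have h3 : LinearMap.det B * LinearMap.det (1 - Y) = 1 := by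
    rw [mul_comm, ← LinearMap.det_comp, hB, Module.End.one_eq_id, LinearMap.det_id]
  rw [h2, mul_assoc, h3, mul_one]

end Cycle

namespace Labelling

/-! ### The reduced relations -/

section Reduced

variable {K G E : Type*} [Field K] [Group G] [AddCommGroup E] [Module K E]
variable {Q N : ℕ} (c : Labelling G Q N) (φ : Representation K G E)

/-- On the values `u_k = z_{k+1} - m_k z_k` of a derivation, expressed by its values `z_k` at the
products `m_{k-1} ⋯ m_0`, the elimination has a closed form. -/
theorem elim_eq (z u : ZMod Q → E) (hu : ∀ k, u k = z (k + 1) - φ (c.a k 0) (z k)) (i : ℕ)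
    (hi : i ≤ N + 1) (k : ZMod Q) :
    c.elim φ i u k = z k - φ (c.a k (N + 1 - i)) (z k) +
      φ (c.word (i + 1) k) (z (k - i) - z (k - i - 1)) := by
  induction i generalizing k with
  | zero =>
    rw [elim_zero, hu, Nat.sub_zero, c.label_last, word_succ]
    simp
  | succ i ih =>
    rw [elim_succ, ih (by omega), hu, c.word_succ (i + 1), sub_add_cancel,
      show N + 1 - (i + 1) = N - i by omega]
    have h1 := c.label_mul_first k (j := N - i) (by omega)
    rw [show N - i + 1 = N + 1 - i by omega] at h1
    have h2 : k - ((i + 1 : ℕ) : ZMod Q) = k - 1 - i := by push_cast; ring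
    rw [h2]
    simp only [map_add, map_sub, rep_mul_apply, h1]
    abel

/-- In the coordinates `z_k` the reduced relations say that `z_k - Y z_{k-P}` is constant. -/
theorem reduced_eq [NeZero Q] (z u : ZMod Q → E)
    (hu : ∀ k, u k = z (k + 1) - φ (c.a k 0) (z k)) :
    c.reduced φ u =
      difference K E Q (twistedShift (φ (c.word (N + 2) 0)) ((N + 2 : ℕ) : ZMod Q) z) := by
  funext k
  change c.elim φ (N + 1) u k - u k = _
  rw [c.elim_eq φ z u hu _ le_rfl, hu, Nat.sub_self, c.word_full, difference_apply,
    twistedShift_apply, twistedShift_apply]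
  have h1 : k - ((N + 2 : ℕ) : ZMod Q) = k - ((N + 1 : ℕ) : ZMod Q) - 1 := by push_cast; ring
  have h2 : k + 1 - ((N + 2 : ℕ) : ZMod Q) = k - ((N + 1 : ℕ) : ZMod Q) := by push_cast; ring
  rw [h1, h2, map_sub]
  abel

theorem elim_principal (v : E) (i : ℕ) (hi : i ≤ N + 1) (k : ZMod Q) :
    c.elim φ i (fun k => φ (c.a k 0) v - v) k = φ (c.a k (N + 1 - i)) v - v := by
  induction i generalizing k with
  | zero => rw [elim_zero, Nat.sub_zero, c.label_last]
  | succ i ih =>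
    have h1 := c.label_mul_first k (j := N - i) (by omega)
    rw [show N - i + 1 = N + 1 - i by omega] at h1
    rw [elim_succ, ih (by omega), show N + 1 - (i + 1) = N - i by omega]
    simp only [map_sub, rep_mul_apply, h1]
    abel

theorem reduced_principal (v : E) : c.reduced φ (fun k => φ (c.a k 0) v - v) = 0 := by
  funext k
  change c.elim φ (N + 1) _ k - (φ (c.a k 0) v - v) = _
  rw [c.elim_principal φ v _ le_rfl, Nat.sub_self, sub_self]
  rfl

/-- The values of a derivation at the `m_k`, expressed by its values `z_k`, `0 < k < Q`, at the
products `m_{k-1} ⋯ m_0` and its value `z_0` at `x = m_{Q-1} ⋯ m_0`. -/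
def chain : Module.End K (ZMod Q → E) :=
  LinearMap.funLeft K E (Equiv.addRight 1) ∘ₗ subdiagonal fun k => φ (c.a (k - 1) 0)

theorem chain_apply (z : ZMod Q → E) (k : ZMod Q) :
    c.chain φ z k = z (k + 1) - φ (c.a k 0) (cut K E Q z k) := by
  change z (k + 1) - φ (c.a (k + 1 - 1) 0) (cut K E Q z (k + 1 - 1)) = _
  rw [add_sub_cancel_right]

/-- The values of the principal derivation in the coordinates of `chain`. -/
def chainPrincipal : E →ₗ[K] (ZMod Q → E) :=
  LinearMap.pi fun k => φ (c.word ((k - 1).val + 1) k) - 1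

theorem chainPrincipal_apply (v : E) (k : ZMod Q) :
    c.chainPrincipal φ v k = φ (c.word ((k - 1).val + 1) k) v - v := rfl

variable [NeZero Q]

theorem cut_chainPrincipal (v : E) (k : ZMod Q) :
    cut K E Q (c.chainPrincipal φ v) k = φ (c.word k.val k) v - v := by
  by_cases h : k = 0
  · simp [h]
  · rw [cut_of_ne _ h, chainPrincipal_apply, val_sub_one_add_one h]

theorem chain_chainPrincipal (v : E) :
    c.chain φ (c.chainPrincipal φ v) = fun k => φ (c.a k 0) v - v := by
  funext k
  rw [chain_apply, cut_chainPrincipal, chainPrincipal_apply, add_sub_cancel_right, word_succ,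
    add_sub_cancel_right, map_sub, rep_mul_apply]
  abel

theorem chainPrincipal_zero (v : E) :
    c.chainPrincipal φ v 0 = φ (c.word Q 0) v - v := by
  rw [chainPrincipal_apply, val_zero_sub_one_add_one]

theorem reduced_comp_chain_comp_cut :
    c.reduced φ ∘ₗ c.chain φ ∘ₗ cut K E Q = difference K E Q ∘ₗ
      twistedShift (φ (c.word (N + 2) 0)) ((N + 2 : ℕ) : ZMod Q) ∘ₗ cut K E Q := by
  refine LinearMap.ext fun z => ?_
  refine c.reduced_eq φ (cut K E Q z) _ fun k => ?_
  rw [LinearMap.comp_apply, chain_apply, cut_congr (z := cut K E Q z) (z' := z) fun _ hk =>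
    cut_of_ne z hk]

variable [FiniteDimensional K E]

theorem det_chain : LinearMap.det (c.chain φ) =
    (((Equiv.Perm.sign (Equiv.addRight (1 : ZMod Q)) : ℤˣ) : ℤ) : K) ^ Module.finrank K E := by
  rw [chain, LinearMap.det_comp, det_subdiagonal, mul_one, det_funLeft_perm]

/-- The determinant of the reduced relations, completed by the value `l` of a derivation at `x`. -/
theorem exists_det_reduced (hX : LinearMap.det (φ (c.word Q 0) - 1) ≠ 0)
    (hY : LinearMap.det (1 - φ (c.word (N + 2) 0)) ≠ 0) :
    ∃ (l : (ZMod Q → E) →ₗ[K] E) (ε : ℤˣ),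
      (∀ v, l (fun k => φ (c.a k 0) v - v) = φ (c.word Q 0) v - v) ∧
      LinearMap.det (c.reduced φ + LinearMap.single K (fun _ => E) 0 ∘ₗ l) *
        LinearMap.det (1 - φ (c.word (N + 2) 0)) =
      ((ε : ℤ) : K) ^ Module.finrank K E *
        LinearMap.det (twistedShift (φ (c.word (N + 2) 0)) ((N + 2 : ℕ) : ZMod Q)) := by
  obtain ⟨ε, hε⟩ : ∃ ε, Equiv.Perm.sign (Equiv.addRight (1 : ZMod Q)) = ε := ⟨_, rfl⟩
  have hdet := c.det_chain φ
  rw [hε] at hdet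
  have hεε : ((ε : ℤ) : K) ^ Module.finrank K E * ((ε : ℤ) : K) ^ Module.finrank K E = 1 := by
    rw [← mul_pow, ← Int.cast_mul, ← Units.val_mul, Int.units_mul_self]
    simp
  obtain ⟨B, hB, hB'⟩ := exists_inverse (A := c.chain φ) (by
    rw [hdet]
    exact left_ne_zero_of_mul_eq_one hεε)
  have hB1 : ∀ z, B (c.chain φ z) = z := fun z => LinearMap.congr_fun hB' z
  -- In the coordinates of `chain`, the value at `x` is the component at `0`.
  refine ⟨LinearMap.proj 0 ∘ₗ B, ε, fun v => ?_, ?_⟩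
  · rw [← c.chain_chainPrincipal φ v, LinearMap.comp_apply, hB1, LinearMap.proj_apply,
      chainPrincipal_zero]
  · have h0 : (c.reduced φ + LinearMap.single K (fun _ => E) 0 ∘ₗ (LinearMap.proj 0 ∘ₗ B)) ∘ₗ
        c.chain φ = c.reduced φ ∘ₗ c.chain φ +
          LinearMap.single K (fun _ => E) 0 ∘ₗ LinearMap.proj 0 := by
      refine LinearMap.ext fun z => ?_
      simp only [LinearMap.comp_apply, LinearMap.add_apply, hB1]
    have h1 := det_add_comp_eq_replace (T := c.reduced φ ∘ₗ c.chain φ) (d := c.chainPrincipal φ)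
      (LinearMap.ext fun v => by
        rw [LinearMap.comp_apply, LinearMap.comp_apply, chain_chainPrincipal, reduced_principal]
        rfl)
      (LinearMap.single K (fun _ => E) 0) (LinearMap.single K (fun _ => E) 0) (LinearMap.proj 0)
      (by
        convert hX using 2
        exact LinearMap.ext fun v => c.chainPrincipal_zero φ v)
      (LinearMap.ext fun v => by simp)
    rw [← h0, LinearMap.det_comp, hdet, LinearMap.comp_assoc, ← cut,
      reduced_comp_chain_comp_cut] at h1
    rw [← det_difference_comp _ _ hY, ← h1]
    linear_combination (-LinearMap.det (c.reduced φ + LinearMap.single K (fun _ => E) 0 ∘ₗ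
      (LinearMap.proj 0 ∘ₗ B)) * LinearMap.det (1 - φ (c.word (N + 2) 0))) * hεε

end Reduced

end Labelling

/-! ### The minors of the relations of a labelling -/

namespace Labelling

variable {K G E : Type*} [Field K] [Group G] [AddCommGroup E] [Module K E]
  [FiniteDimensional K E]

/-- The determinant of the linearized Wirtinger relations, in which one block row and one block
column are joined by an additional entry. -/
theorem exists_det_relations_add {μ p q N : ℕ} [NeZero μ] [NeZero q] (hN : N + 2 = μ * p)
    (hpq : Nat.Coprime p q) (c : Labelling G (μ * q) N) (φ : Representation K G E)
    (hX : LinearMap.det (φ (c.word (μ * q) 0) - 1) ≠ 0)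
    (hY : LinearMap.det (φ (c.word (N + 2) 0) - 1) ≠ 0)
    (l : (Fin (N + 1) → ZMod (μ * q) → E) →ₗ[K] E)
    (hl : LinearMap.det (l ∘ₗ c.principal φ) ≠ 0) (j : Fin (N + 1)) (k : ZMod (μ * q)) :
    ∃ ε : ℤˣ,
      LinearMap.det (c.relations φ + incl j k ∘ₗ l) * LinearMap.det (φ (c.word (μ * q) 0) - 1) *
        LinearMap.det (φ (c.word (N + 2) 0) - 1) =
      ((ε : ℤ) : K) ^ Module.finrank K E * LinearMap.det (φ (c.pre k j)) *
        LinearMap.det (φ (c.word (N + 2) 0) ^ q - 1) ^ μ *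
          LinearMap.det (l ∘ₗ c.principal φ) := by
  have hs : (((-1 : ℤˣ) : ℤ) : K) ^ Module.finrank K E ≠ 0 := by simp
  obtain ⟨l', ε, hl', h⟩ := c.exists_det_reduced φ hX
    (by rw [det_one_sub]; exact mul_ne_zero hs hY)
  have hl'd : (l' ∘ₗ LinearMap.proj 0) ∘ₗ c.principal φ = φ (c.word (μ * q) 0) - 1 :=
    LinearMap.ext fun v => hl' v
  have h1 := c.det_relations φ (LinearMap.single K (fun _ => E) 0) l'
  have hL : LinearMap.det (c.identity φ ∘ₗ incl (0 : Fin (N + 1)) (0 : ZMod (μ * q))) = 1 := by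
    rw [identity_comp_incl]
    simp
  have h2 := det_add_comp_change_left (c.identity_comp_relations φ)
    (incl (0 : Fin (N + 1)) (0 : ZMod (μ * q))) (incl j k) l (by rw [hL]; exact one_ne_zero)
  have h3 := det_add_comp_change_right (c.relations_comp_principal φ)
    (incl (0 : Fin (N + 1)) (0 : ZMod (μ * q))) l (l' ∘ₗ LinearMap.proj 0) hl
  rw [hL, mul_one, identity_comp_incl] at h2
  rw [hl'd] at h3
  rw [det_one_sub, hN, det_twistedShift μ p q hpq, det_one_sub, ← hN] at h
  change LinearMap.det (_ + incl 0 0 ∘ₗ _) = _ at h1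
  rw [h1] at h3
  refine ⟨-1 * ((-1) ^ (N * (μ * q)) * ε * (-1) ^ μ), ?_⟩
  have hs2 : (((-1 : ℤˣ) : ℤ) : K) ^ Module.finrank K E *
      (((-1 : ℤˣ) : ℤ) : K) ^ Module.finrank K E = 1 := by
    rw [← mul_pow]
    simp
  rw [h2]
  generalize LinearMap.det (φ (c.word (N + 2) 0) - 1) = dY at *
  generalize LinearMap.det (φ (c.word (μ * q) 0) - 1) = dX at *
  generalize LinearMap.det (c.relations φ + incl 0 0 ∘ₗ l) = D at *
  generalize LinearMap.det (c.reduced φ + LinearMap.single K (fun _ => E) 0 ∘ₗ l') = R at *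
  generalize LinearMap.det (φ (c.word (N + 2) 0) ^ q - 1) = H at *
  have e1 : (((-1 : ℤˣ) : ℤ) : K) = -1 := by simp
  simp only [Units.val_mul, Units.val_pow_eq_pow_val, Int.cast_mul, Int.cast_pow, mul_pow, e1]
    at h hs2 ⊢
  have e2 : ((-1 : K) ^ μ) ^ Module.finrank K E = ((-1) ^ Module.finrank K E) ^ μ := by
    rw [← pow_mul, ← pow_mul, mul_comm]
  rw [e2]
  generalize (-1 : K) ^ Module.finrank K E = s at *
  generalize ((-1 : K) ^ (N * (μ * q))) ^ Module.finrank K E = s' at *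
  linear_combination (-LinearMap.det (φ (c.pre k j)) * dY) * h3 +
    (LinearMap.det (φ (c.pre k j)) * s * s' * LinearMap.det (l ∘ₗ c.principal φ)) * h -
    (LinearMap.det (φ (c.pre k j)) * s' * LinearMap.det (l ∘ₗ c.principal φ) * R * dY) * hs2

end Labelling

/-! ### Fox calculus and derivations -/

section FoxCalculus

variable {K : Type*} [Field K] {n : ℕ}

/-- The action of a group on column vectors through matrices. -/
def matRep {G : Type*} [Group G] (Ψ : G →* Matrix (Fin n) (Fin n) K) :
    Representation K G (Fin n → K) :=
  (MonoidHomClass.toMonoidHom (Matrix.toLinAlgEquiv' (R := K) (n := Fin n))).comp Ψ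

theorem matRep_apply {G : Type*} [Group G] (Ψ : G →* Matrix (Fin n) (Fin n) K) (g : G)
    (v : Fin n → K) : matRep Ψ g v = (Ψ g).mulVec v := rfl

theorem det_matRep {G : Type*} [Group G] (Ψ : G →* Matrix (Fin n) (Fin n) K) (g : G) :
    LinearMap.det (matRep Ψ g) = (Ψ g).det :=
  LinearMap.det_toLin' _

theorem det_matRep_sub_one {G : Type*} [Group G] (Ψ : G →* Matrix (Fin n) (Fin n) K) (g : G) :
    LinearMap.det (matRep Ψ g - 1) = (Ψ g - 1).det := by
  have h : matRep Ψ g - 1 = Matrix.toLin' (Ψ g - 1) := LinearMap.ext fun v => by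
    rw [Matrix.toLin'_apply, Matrix.sub_mulVec, Matrix.one_mulVec]
    rfl
  rw [h, LinearMap.det_toLin']

variable {ι : Type*} [DecidableEq ι] [Fintype ι] (Φ : FreeGroup ι →* Matrix (Fin n) (Fin n) K)

/-- The value at a word of the derivation with given values `w` at the generators, computed by
the free derivatives. -/
def derivation (g : FreeGroup ι) : (ι → Fin n → K) →ₗ[K] (Fin n → K) :=
  ∑ v, (MonoidAlgebra.lift ℤ _ _ Φ (fox v g)).mulVecLin ∘ₗ LinearMap.proj v

theorem derivation_apply (g : FreeGroup ι) (w : ι → Fin n → K) :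
    derivation Φ g w = ∑ v, (MonoidAlgebra.lift ℤ _ _ Φ (fox v g)).mulVec (w v) := by
  simp [derivation]

theorem derivation_of (i : ι) (w : ι → Fin n → K) :
    derivation Φ (FreeGroup.of i) w = w i := by
  rw [derivation_apply, Finset.sum_eq_single i]
  · simp [fox_of]
  · intro v _ hv
    simp [fox_of, hv.symm]
  · simp

theorem derivation_mul (g h : FreeGroup ι) (w : ι → Fin n → K) :
    derivation Φ (g * h) w = derivation Φ g w + (Φ g).mulVec (derivation Φ h w) := by
  simp only [derivation_apply, fox_mul, map_add, map_mul, MonoidAlgebra.lift_of, Matrix.add_mulVec,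
    Finset.sum_add_distrib, Matrix.mulVec_sum, Matrix.mulVec_mulVec]

theorem derivation_one (w : ι → Fin n → K) : derivation Φ 1 w = 0 := by
  have := derivation_mul Φ 1 1 w
  simpa using this

theorem derivation_inv (g : FreeGroup ι) (w : ι → Fin n → K) :
    derivation Φ g⁻¹ w = -(Φ g⁻¹).mulVec (derivation Φ g w) := by
  have := derivation_mul Φ g⁻¹ g w
  rw [inv_mul_cancel, derivation_one] at this
  exact eq_neg_of_add_eq_zero_left this.symm

/-- The value of a derivation at a relator `o i o⁻¹ u⁻¹` which holds under `Φ`. -/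
theorem derivation_conj_relator (o i u : ι)
    (h : Φ (FreeGroup.of o * FreeGroup.of i * (FreeGroup.of o)⁻¹) = Φ (FreeGroup.of u))
    (w : ι → Fin n → K) :
    derivation Φ (FreeGroup.of o * FreeGroup.of i * (FreeGroup.of o)⁻¹ * (FreeGroup.of u)⁻¹) w =
      w o - (Φ (FreeGroup.of u)).mulVec (w o) + (Φ (FreeGroup.of o)).mulVec (w i) - w u := by
  have h1 : Φ (FreeGroup.of o * FreeGroup.of i) * Φ (FreeGroup.of o)⁻¹ =
      Φ (FreeGroup.of u) := by
    rw [← map_mul, h]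
  have h2 : Φ (FreeGroup.of u) * Φ (FreeGroup.of u)⁻¹ = 1 := by
    rw [← map_mul, mul_inv_cancel, map_one]
  rw [derivation_mul, derivation_mul, derivation_mul, derivation_inv, derivation_inv, h]
  simp only [derivation_of, Matrix.mulVec_neg, Matrix.mulVec_mulVec, h1, h2, Matrix.one_mulVec]
  abel

/-- The minors of the Alexander matrix as determinants of operators. -/
theorem det_submatrix_alexanderMatrix {m : ℕ}
    (Φ : FreeGroup (Fin (m + 1)) →* Matrix (Fin n) (Fin n) K)
    (r : Fin m → FreeGroup (Fin (m + 1))) (j : Fin (m + 1)) :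
    ((alexanderMatrix Φ r).submatrix id
      (fun v : Fin m × Fin n => (j.succAbove v.1, v.2))).det =
    LinearMap.det (LinearMap.pi fun i => derivation Φ (r i) ∘ₗ
      LinearMap.pi (j.insertNth (α := fun _ => (Fin m → Fin n → K) →ₗ[K] (Fin n → K)) 0
        fun i => LinearMap.proj i)) := by
  rw [← LinearMap.det_toLin', ← LinearMap.det_conj _ (LinearEquiv.curry K K (Fin m) (Fin n))]
  congr 1
  refine LinearMap.ext fun w => ?_
  ext i x
  simp only [LinearMap.comp_apply, LinearMap.pi_apply, LinearEquiv.coe_coe, derivation_apply]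
  rw [Fin.sum_univ_succAbove _ j]
  simp only [Fin.insertNth_apply_same, LinearMap.zero_apply, Matrix.mulVec_zero, zero_add,
    Fin.insertNth_apply_succAbove, LinearMap.proj_apply, Finset.sum_apply]
  change (Matrix.toLin' _ _) (i, x) = _
  rw [Matrix.toLin'_apply, Matrix.mulVec, dotProduct, Fintype.sum_prod_type]
  rfl

end FoxCalculus

/-! ### Arcs and crossings of the torus link diagram -/

section Diagram

variable {μ p q : ℕ}

theorem arc_last (k : ZMod (μ * q)) {i i' : Fin (μ * p)} (hi : i.val = 0)
    (hi' : i'.val + 1 = μ * p) : (arc k i : Arc μ p q) = arc (k + 1) i' :=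
  Quot.sound (Joined.over k i i' hi hi')

/-- Each arc contains exactly one segment which is not in the last position. -/
def arcEquiv {N : ℕ} (hN : N + 2 = μ * p) : Fin (N + 1) × ZMod (μ * q) ≃ Arc μ p q where
  toFun x := arc x.2 ⟨x.1, by have := x.1.isLt; omega⟩
  invFun := Quot.lift
    (fun s => if h : s.2.val < N + 1 then (⟨s.2.val, h⟩, s.1) else (0, s.1 - 1)) (by
      rintro _ _ ⟨k, i, i', hi, hi'⟩
      have h : ¬ i'.val < N + 1 := by omega
      simp [hi, h])
  left_inv x := dif_pos x.1.isLt
  right_inv a := by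
    induction a using Quot.inductionOn with
    | _ s =>
      obtain ⟨k, i⟩ := s
      by_cases h : i.val < N + 1
      · simp only [h, dite_true]
        rfl
      · simp only [h, dite_false]
        rw [arc_last (k - 1) (i' := i) (by simp) (by have := i.isLt; omega), sub_add_cancel]
        rfl

/-- Each arc starts at exactly one crossing. -/
def crossingEquiv {N : ℕ} (hN : N + 2 = μ * p) :
    Crossing μ p q ≃ Fin (N + 1) × ZMod (μ * q) where
  toFun c := (⟨c.2, by have := c.2.isLt; omega⟩, c.1 + 1)
  invFun x := (x.2 - 1, ⟨x.1, by have := x.1.isLt; omega⟩)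
  left_inv c := by simp
  right_inv x := by simp

theorem arcEquiv_symm_arc {N : ℕ} (hN : N + 2 = μ * p) (k : ZMod (μ * q)) (i : Fin (μ * p)) :
    (arcEquiv hN).symm (arc k i) =
      if h : i.val < N + 1 then (⟨i.val, h⟩, k) else (0, k - 1) := rfl

theorem meridian_outArc (c : Crossing μ p q) :
    meridian (outArc c) =
      meridian (overArc c) * meridian (inArc c) * (meridian (overArc c))⁻¹ := by
  have h : (PresentedGroup.mk (Set.range (wirtinger (μ := μ) (p := p) (q := q)))) (wirtinger c) =
      1 := PresentedGroup.one_of_mem ⟨c, rfl⟩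
  simp only [wirtinger, map_mul, map_inv] at h
  exact (mul_inv_eq_one.1 h).symm

/-- The labelling of the strand segments by their meridians. -/
def meridianLabelling {N : ℕ} (hN : N + 2 = μ * p) : Labelling (LinkGroup μ p q) (μ * q) N where
  a k i := if h : i < μ * p then meridian (arc k ⟨i, h⟩) else 1
  undercross k i hi := by
    rw [dif_pos (by omega), dif_pos (by omega), dif_pos (by omega)]
    exact meridian_outArc (k, ⟨i, by omega⟩)
  overcross k := by
    rw [dif_pos (by omega), dif_pos (by omega),
      arc_last k (i := ⟨0, by omega⟩) (i' := ⟨N + 1, by omega⟩) rfl (by simp; omega)]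

theorem meridianLabelling_a {N : ℕ} (hN : N + 2 = μ * p) (k : ZMod (μ * q)) (i : Fin (μ * p)) :
    (meridianLabelling hN).a k i = meridian (arc k i) := by
  simp [meridianLabelling]

theorem Labelling.prod_reverse_range {G : Type*} [Group G] {Q N : ℕ} (c : Labelling G Q N)
    (i : ℕ) : ((List.range i).reverse.map fun k : ℕ => c.a k 0).prod = c.word i i := by
  induction i with
  | zero => simp
  | succ i ih =>
    rw [List.range_succ, List.reverse_append, List.reverse_singleton, List.singleton_append,
      List.map_cons, List.prod_cons, ih, word_succ, Nat.cast_succ, add_sub_cancel_right]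

theorem Labelling.prod_ofFn {G : Type*} [Group G] {Q N : ℕ} (c : Labelling G Q N)
    (k : ZMod Q) (j : ℕ) : (List.ofFn fun i : Fin j => c.a k i).prod = c.pre k j := by
  induction j with
  | zero => simp
  | succ j ih =>
    rw [List.ofFn_succ', List.concat_eq_append, List.prod_append, List.prod_singleton, pre_succ,
      ← ih]
    rfl

theorem coreX_eq_word {N : ℕ} (hN : N + 2 = μ * p) (hp : 0 < μ * p) :
    coreX (q := q) hp = (meridianLabelling hN).word (μ * q) 0 := by
  have h := (meridianLabelling (q := q) hN).prod_reverse_range (μ * q)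
  rw [ZMod.natCast_self] at h
  rw [← h, coreX]
  congr 2
  funext k
  exact (meridianLabelling_a hN _ ⟨0, hp⟩).symm

theorem coreY_eq_word {N : ℕ} (hN : N + 2 = μ * p) :
    coreY (q := q) = (meridianLabelling hN).word (N + 2) 0 := by
  rw [← Labelling.pre_full, hN, ← Labelling.prod_ofFn, coreY]
  congr 2
  funext i
  exact (meridianLabelling_a hN _ i).symm

theorem entry_eq_arcEquiv {K E : Type*} [Field K] [AddCommGroup E] [Module K E] {N : ℕ}
    (hN : N + 2 = μ * p) (k : ZMod (μ * q)) (i : Fin (μ * p))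
    (w : Fin (N + 1) → ZMod (μ * q) → E) :
    Labelling.entry (K := K) i k w =
      w ((arcEquiv hN).symm (arc k i)).1 ((arcEquiv hN).symm (arc k i)).2 := by
  by_cases h : i.val < N + 1
  · rw [Labelling.entry_of_lt h, arcEquiv_symm_arc, dif_pos h]
  · rw [Labelling.entry_of_not_lt h, arcEquiv_symm_arc, dif_neg h]

/-- A family of all the members of a finite type but one can be completed to a numbering. -/
theorem exists_equiv_extending {α : Type*} [Fintype α] {m : ℕ} (hα : Fintype.card α = m + 1)
    (f : Fin m ↪ α) (j : Fin (m + 1)) :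
    ∃ g : Fin (m + 1) ≃ α, ∀ i, g (j.succAbove i) = f i := by
  classical
  obtain ⟨c, hc⟩ : ∃ c, c ∉ Set.range f := by
    by_contra! h
    have := Fintype.card_le_of_surjective f h
    simp [hα] at this
  have hinj : Function.Injective (j.insertNth (α := fun _ => α) c f) := by
    intro a b
    refine Fin.succAboveCases j ?_ (fun a => ?_) a <;>
      refine Fin.succAboveCases j ?_ (fun b => ?_) b <;>
      simp only [Fin.insertNth_apply_same, Fin.insertNth_apply_succAbove]
    · exact fun _ => trivial
    · exact fun h => absurd ⟨b, h.symm⟩ hc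
    · exact fun h => absurd ⟨a, h⟩ hc
    · exact fun h => congrArg _ (f.injective h)
  exact ⟨Equiv.ofBijective _ ((Fintype.bijective_iff_injective_and_card _).2
    ⟨hinj, by simp [hα]⟩), fun i => by simp⟩

end Diagram

/-! ### The minors of the Alexander matrix -/

section Minor

variable {K : Type*} [Field K] {n μ p q : ℕ}

/-- The derivation with given values at the arcs takes at the Wirtinger relators the values of the
linearized relations. -/
theorem derivation_wirtinger {N m : ℕ} (hN : N + 2 = μ * p)
    (Ψ : LinkGroup μ p q →* Matrix (Fin n) (Fin n) K) (e : Fin (m + 1) ≃ Arc μ p q)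
    (c : Crossing μ p q) (w : Fin (N + 1) → ZMod (μ * q) → Fin n → K) :
    derivation (Ψ.comp (FreeGroup.lift fun i => meridian (e i)))
        (FreeGroup.map e.symm (wirtinger c))
        (fun i => w ((arcEquiv hN).symm (e i)).1 ((arcEquiv hN).symm (e i)).2) =
      (meridianLabelling hN).relations (matRep Ψ) w (crossingEquiv hN c).1
        (crossingEquiv hN c).2 := by
  have hj := c.2.isLt
  simp only [wirtinger, map_mul, map_inv, FreeGroup.map.of]
  rw [derivation_conj_relator]
  · simp only [MonoidHom.comp_apply, FreeGroup.lift_apply_of, Equiv.apply_symm_apply]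
    rw [Labelling.relations_apply, Labelling.row_apply, matRep_apply, matRep_apply]
    have h0 : (w 0 c.1 : Fin n → K) = Labelling.entry (K := K) 0 c.1 w := by
      rw [Labelling.entry_of_lt (Nat.succ_pos N)]
      rfl
    simp only [crossingEquiv, Equiv.coe_fn_mk, add_sub_cancel_right]
    rw [h0]
    have h1 := entry_eq_arcEquiv (K := K) hN c.1 ⟨0, by omega⟩ w
    have h2 := entry_eq_arcEquiv (K := K) hN c.1 ⟨c.2.val + 1, by omega⟩ w
    have h3 := entry_eq_arcEquiv (K := K) hN (c.1 + 1) ⟨c.2.val, by omega⟩ w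
    have h4 := meridianLabelling_a hN c.1 ⟨0, by omega⟩
    have h5 := meridianLabelling_a hN (c.1 + 1) ⟨c.2.val, by omega⟩
    simp only at h1 h2 h3 h4 h5
    rw [h1, h2, h3, h4, h5]
    rfl
  · simp only [MonoidHom.comp_apply, map_mul, map_inv, FreeGroup.lift_apply_of,
      Equiv.apply_symm_apply]
    rw [meridian_outArc, map_mul, map_mul]

variable [NeZero μ]

/-- The minors of the Alexander matrix of a torus link diagram, in terms of the images of the
cores of the two solid tori. -/
theorem exists_det_minor (hp : 0 < p) (hq : 0 < q) (hpq : Nat.Coprime p q)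
    (Ψ : LinkGroup μ p q →* Matrix (Fin n) (Fin n) K) {m : ℕ} (e : Fin (m + 1) ≃ Arc μ p q)
    (f : Fin m ↪ Crossing μ p q) (j : Fin (m + 1))
    (hX : (Ψ (coreX (Nat.mul_pos (NeZero.pos μ) hp)) - 1).det ≠ 0)
    (hY : (Ψ coreY - 1).det ≠ 0) (hj : (Ψ (meridian (e j)) - 1).det ≠ 0) :
    ∃ (ε : ℤˣ) (g : LinkGroup μ p q),
      ((alexanderMatrix (Ψ.comp (FreeGroup.lift fun i => meridian (e i)))
          fun i => FreeGroup.map e.symm (wirtinger (f i))).submatrix id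
        (fun v : Fin m × Fin n => (j.succAbove v.1, v.2))).det *
          (Ψ (coreX (Nat.mul_pos (NeZero.pos μ) hp)) - 1).det * (Ψ coreY - 1).det =
      ((ε : ℤ) : K) ^ n * (Ψ g).det * (Ψ (coreY ^ q) - 1).det ^ μ *
        (Ψ (meridian (e j)) - 1).det := by
  have : NeZero q := ⟨hq.ne'⟩
  have : NeZero p := ⟨hp.ne'⟩
  by_cases hP : μ * p = 1
  · -- A single strand: there are no crossings, and the link group is infinite cyclic.
    obtain rfl : μ = 1 := Nat.eq_one_of_mul_eq_one_right hP
    obtain rfl : p = 1 := by omega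
    have hm : m = 0 := by
      rcases Nat.eq_zero_or_pos m with h | h
      · exact h
      · exact absurd (f ⟨0, h⟩).2.isLt (by simp)
    subst hm
    have harc : ∀ (k : ZMod (1 * q)) (i : Fin (1 * 1)), meridian (arc k i) =
        meridian (e j) := by
      intro k i
      congr 1
      apply e.symm.injective
      have : Subsingleton (Fin (0 + 1)) := inferInstanceAs (Subsingleton (Fin 1))
      exact Subsingleton.elim _ _
    have hy : (coreY : LinkGroup 1 1 q) = meridian (e j) := by
      simp only [coreY, harc]
      simp
    have hx : coreX (Nat.mul_pos (NeZero.pos 1) hp) = meridian (e j) ^ q := by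
      simp only [coreX, harc]
      simp
    refine ⟨1, 1, ?_⟩
    rw [hx, hy, Matrix.det_isEmpty]
    simp
  · obtain ⟨N, hN⟩ : ∃ N, N + 2 = μ * p := by
      have : 0 < μ * p := Nat.mul_pos (NeZero.pos μ) hp
      exact ⟨μ * p - 2, by omega⟩
    let c := meridianLabelling (q := q) hN
    let e' : Fin (m + 1) ≃ Fin (N + 1) × ZMod (μ * q) := e.trans (arcEquiv hN).symm
    obtain ⟨fc, hfc⟩ := exists_equiv_extending (by
      have h1 := Fintype.card_congr e'
      have h2 := Fintype.card_congr (crossingEquiv (q := q) hN)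
      rw [h2, ← h1, Fintype.card_fin]) f j
    let g : Fin (m + 1) ≃ Fin (N + 1) × ZMod (μ * q) := fc.trans (crossingEquiv hN)
    let Φ := Ψ.comp (FreeGroup.lift fun i => meridian (e i))
    let M : Module.End K (Fin (m + 1) → Fin n → K) :=
      LinearMap.pi fun i => derivation Φ (FreeGroup.map e.symm (wirtinger (fc i)))
    let C : (Fin (N + 1) → ZMod (μ * q) → Fin n → K) ≃ₗ[K]
        (Fin (N + 1) × ZMod (μ * q) → Fin n → K) := (LinearEquiv.curry K _ _ _).symm
    let F : (Fin (N + 1) → ZMod (μ * q) → Fin n → K) ≃ₗ[K] (Fin (m + 1) → Fin n → K) :=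
      C.trans (LinearEquiv.funCongrLeft K _ e')
    have hF : ∀ w i, F w i = w (e' i).1 (e' i).2 := fun _ _ => rfl
    let l : (Fin (N + 1) → ZMod (μ * q) → Fin n → K) →ₗ[K] (Fin n → K) :=
      Labelling.entry (e' j).1 (e' j).2
    have hl : ∀ w, l w = w (e' j).1 (e' j).2 := fun w => Labelling.entry_of_lt (e' j).1.isLt _ w
    -- The given numberings of arcs and crossings differ by `τ` from the one in which each crossing
    -- has the index of the arc that emerges from it.
    let τ : Equiv.Perm (Fin (N + 1) × ZMod (μ * q)) := e'.symm.trans g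
    have hMF : ∀ w i, M (F w) i = c.relations (matRep Ψ) w (g i).1 (g i).2 := fun w i =>
      derivation_wirtinger hN Ψ e (fc i) w
    have hincl : ∀ (x y : Fin (N + 1) × ZMod (μ * q)) (v : Fin n → K),
        Labelling.incl (K := K) x.1 x.2 v y.1 y.2 = if y = x then v else 0 := by
      intro x y v
      by_cases h1 : y.1 = x.1
      · by_cases h2 : y.2 = x.2
        · simp [Labelling.incl, h1, h2, Prod.ext_iff]
        · simp [Labelling.incl, h1, h2, Prod.ext_iff]
      · simp [Labelling.incl, h1, Prod.ext_iff]
    have hcut : ∀ w, (1 - LinearMap.single K (fun _ => Fin n → K) j ∘ₗ LinearMap.proj j :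
        Module.End K _) (F w) = F ((1 - Labelling.incl (e' j).1 (e' j).2 ∘ₗ l) w) := by
      intro w
      funext i
      rw [hF]
      simp only [LinearMap.sub_apply, LinearMap.comp_apply, Pi.sub_apply, Module.End.one_apply,
        hincl, hF, hl, LinearMap.proj_apply, LinearMap.coe_single, Pi.single_apply,
        EmbeddingLike.apply_eq_iff_eq]
    have hconj : (F.symm.toLinearMap ∘ₗ
        (M ∘ₗ (1 - LinearMap.single K (fun _ => Fin n → K) j ∘ₗ LinearMap.proj j) +
          LinearMap.single K (fun _ => Fin n → K) j ∘ₗ LinearMap.proj j) ∘ₗ F.toLinearMap) =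
        (C.symm.toLinearMap ∘ₗ LinearMap.funLeft K _ τ ∘ₗ C.toLinearMap) ∘ₗ
          (c.relations (matRep Ψ) ∘ₗ (1 - Labelling.incl (e' j).1 (e' j).2 ∘ₗ l) +
            Labelling.incl (g j).1 (g j).2 ∘ₗ l) := by
      refine LinearMap.ext fun w => F.injective ?_
      funext i
      have hR : ∀ z, F (C.symm (LinearMap.funLeft K _ τ (C z))) i = z (g i).1 (g i).2 := by
        intro z
        change z (τ (e' i)).1 (τ (e' i)).2 = _
        simp [τ]
      simp only [LinearMap.comp_apply, LinearEquiv.coe_coe, LinearEquiv.apply_symm_apply, hR,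
        LinearMap.add_apply, Pi.add_apply, hcut, hMF, hincl, hl, LinearMap.proj_apply,
        LinearMap.coe_single, Pi.single_apply, EmbeddingLike.apply_eq_iff_eq]
      rw [hF]
    have hprin : l ∘ₗ c.principal (matRep Ψ) = matRep Ψ (meridian (e j)) - 1 := by
      refine LinearMap.ext fun v => ?_
      have h1 := meridianLabelling_a hN (e' j).2 ⟨(e' j).1, by have := (e' j).1.isLt; omega⟩
      have h2 : arc (e' j).2 ⟨(e' j).1, by have := (e' j).1.isLt; omega⟩ = e j :=
        (arcEquiv hN).apply_symm_apply (e j)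
      rw [h2] at h1
      rw [LinearMap.comp_apply, hl, Labelling.principal_apply]
      change matRep Ψ ((meridianLabelling hN).a _ _) v - v = _
      rw [h1]
      rfl
    have hld : LinearMap.det (l ∘ₗ c.principal (matRep Ψ)) = (Ψ (meridian (e j)) - 1).det := by
      rw [hprin, det_matRep_sub_one]
    rw [coreX_eq_word hN, coreY_eq_word hN] at *
    obtain ⟨ε, h⟩ := c.exists_det_relations_add hN hpq (matRep Ψ)
      (by rw [det_matRep_sub_one]; exact hX) (by rw [det_matRep_sub_one]; exact hY) l
      (by rw [hld]; exact hj) (g j).1 (g j).2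
    refine ⟨Equiv.Perm.sign τ * ε, c.pre (g j).2 (g j).1, ?_⟩
    have h1 : (matRep Ψ) (c.word (N + 2) 0) ^ q = matRep Ψ (c.word (N + 2) 0 ^ q) :=
      (map_pow _ _ _).symm
    rw [hld, h1, det_matRep_sub_one, det_matRep_sub_one, det_matRep_sub_one, det_matRep] at h
    rw [det_add_comp_eq_replace (c.relations_comp_principal _) _
      (Labelling.incl (e' j).1 (e' j).2) l (by rw [hld]; exact hj)
      (LinearMap.ext fun v => by
        rw [LinearMap.comp_apply, hl, hincl, if_pos rfl, Module.End.one_apply])] at h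
    rw [det_submatrix_alexanderMatrix, det_minor_eq j M, ← LinearMap.det_conj _ F.symm]
    · have h2 := congrArg LinearMap.det hconj
      have h3 : LinearMap.det (C.symm.toLinearMap ∘ₗ LinearMap.funLeft K _ τ ∘ₗ C.toLinearMap) =
          LinearMap.det (LinearMap.funLeft K (Fin n → K) τ) := LinearMap.det_conj _ C.symm
      rw [LinearMap.det_comp, h3, det_funLeft_perm] at h2
      rw [LinearEquiv.symm_symm, h2]
      rw [Module.finrank_fin_fun] at h ⊢
      rw [Units.val_mul, Int.cast_mul, mul_pow]
      linear_combination (((Equiv.Perm.sign τ : ℤˣ) : ℤ) : K) ^ n * h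
    · intro w i
      simp only [LinearMap.pi_apply, LinearMap.comp_apply, M, hfc]
      congr 1
      funext i'
      refine Fin.succAboveCases j ?_ (fun i' => ?_) i' <;> simp

end Minor

/-! ### Eigenvalues of the representations `σ_n` -/

section Sym

theorem substInv_X_mul_X {P : SL(2, ℂ)} {z : ℂ} (hP : P.1 = !![z, 0; 0, z⁻¹]) (i j : ℕ) :
    substInv P (MvPolynomial.X 0 ^ i * MvPolynomial.X 1 ^ j) =
      ((z⁻¹) ^ i * z ^ j) • (MvPolynomial.X 0 ^ i * MvPolynomial.X 1 ^ j) := by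
  have h : (P⁻¹ : SL(2, ℂ)).1 = !![z⁻¹, 0; 0, z] := by
    rw [Matrix.SpecialLinearGroup.coe_inv, hP, Matrix.adjugate_fin_two]
    simp
  simp only [substInv, map_mul, map_pow, MvPolynomial.aeval_X, h, Fin.sum_univ_two]
  simp only [Matrix.of_apply, Matrix.cons_val', Matrix.cons_val_zero, Matrix.cons_val_one,
    Matrix.cons_val_fin_one, map_zero, zero_mul, add_zero, zero_add, mul_pow,
    MvPolynomial.smul_eq_C_mul, map_mul, map_pow]
  ring

/-- The monomial `z_1 ^ i z_2 ^ (n - 1 - i)`. -/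
def symMonomial (n : ℕ) (i : Fin n) : SymSpace n :=
  ⟨MvPolynomial.X 0 ^ (i : ℕ) * MvPolynomial.X 1 ^ (n - 1 - i), by
    have h := ((MvPolynomial.isHomogeneous_X_pow (R := ℂ) (0 : Fin 2) i).mul
      (MvPolynomial.isHomogeneous_X_pow (R := ℂ) (1 : Fin 2) (n - 1 - i)))
    rw [MvPolynomial.mem_homogeneousSubmodule]
    convert h using 1
    have := i.isLt
    omega⟩

theorem linearIndependent_symMonomial (n : ℕ) : LinearIndependent ℂ (symMonomial n) := by
  refine LinearIndependent.of_comp (Submodule.subtype _) ?_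
  have h : (Submodule.subtype _) ∘ symMonomial n = fun i : Fin n =>
      MvPolynomial.basisMonomials (Fin 2) ℂ
        (Finsupp.single 0 (i : ℕ) + Finsupp.single 1 (n - 1 - i)) := by
    funext i
    simp [symMonomial, MvPolynomial.X_pow_eq_monomial, MvPolynomial.monomial_mul]
  rw [h]
  refine (MvPolynomial.basisMonomials (Fin 2) ℂ).linearIndependent.comp _ fun i i' hi => ?_
  have := DFunLike.congr_fun hi 0
  simpa [Fin.ext_iff] using this

/-- `σ_n` has values in `SL(n)`, since `SL(2, ℂ)` is perfect. -/
theorem det_symRep (n : ℕ) (P : SL(2, ℂ)) : LinearMap.det (symRep n P) = 1 := by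
  have h : commutator SL(2, ℂ) = ⊤ :=
    Matrix.SL2.commutator_eq_top (a := (2 : ℂ)) two_ne_zero (by norm_num)
  have h1 := Abelianization.commutator_subset_ker
    ((LinearMap.det.comp (symRep n)).toHomUnits)
  rw [h] at h1
  have h2 := MonoidHom.mem_ker.1 (h1 (Subgroup.mem_top P))
  exact congrArg Units.val h2

/-- If `M` is conjugate to `diag(z, z⁻¹)`, then `σ_n(M)` is diagonalizable with the eigenvalues
`z ^ (n - 1 - 2 i)`. -/
theorem det_smul_symRep_sub_one {K : Type*} [Field K] [Algebra ℂ K] {n : ℕ}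
    (B : Module.Basis (Fin n) ℂ (SymSpace n)) {M : SL(2, ℂ)} {z : ℂ} (h : IsConjDiag M z)
    (hz : z ≠ 0) (s : K) :
    (s • (LinearMap.toMatrix B B (symRep n M)).map (algebraMap ℂ K) - 1).det =
      ∏ i ∈ Finset.range n, (s * algebraMap ℂ K (z ^ ((n : ℤ) - 1 - 2 * i)) - 1) := by
  obtain ⟨C, hC⟩ := h
  -- The eigenvectors of `M` are the translates of the monomials.
  let u : Fin n → SymSpace n := fun i => symRep n C⁻¹ (symMonomial n i)
  have hinv : ∀ v, symRep n C (symRep n C⁻¹ v) = v := fun v => by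
    rw [← Module.End.mul_apply, ← map_mul, mul_inv_cancel, map_one, Module.End.one_apply]
  have hu : LinearIndependent ℂ u :=
    (linearIndependent_symMonomial n).map' _
      (LinearMap.ker_eq_bot_of_inverse (g := symRep n C) (LinearMap.ext hinv))
  have : FiniteDimensional ℂ (SymSpace n) := B.finiteDimensional_of_finite
  have hn : Fintype.card (Fin n) = Module.finrank ℂ (SymSpace n) := by
    rw [Module.finrank_eq_card_basis B]
  rcases Nat.eq_zero_or_pos n with rfl | hn0
  · simp
  have : Nonempty (Fin n) := ⟨⟨0, hn0⟩⟩
  let D := basisOfLinearIndependentOfCardEqFinrank hu hn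
  have hD : ∀ i, D i = u i := fun i => by simp [D]
  have heig : ∀ i : Fin n, symRep n M (D i) = (z ^ ((n : ℤ) - 1 - 2 * (i : ℕ))) • D i := by
    intro i
    rw [hD]
    have h1 : M * C⁻¹ = C⁻¹ * (C * M * C⁻¹) := by group
    have h2 : symRep n (C * M * C⁻¹) (symMonomial n i) =
        (z ^ ((n : ℤ) - 1 - 2 * (i : ℕ))) • symMonomial n i := by
      refine Subtype.ext ((substInv_X_mul_X hC _ _).trans ?_)
      have h3 : (z⁻¹) ^ (i : ℕ) * z ^ (n - 1 - i) = z ^ ((n : ℤ) - 1 - 2 * (i : ℕ)) := by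
        have hi := i.isLt
        rw [inv_pow, ← zpow_natCast, ← zpow_natCast, ← zpow_neg, ← zpow_add₀ hz]
        congr 1
        omega
      rw [h3]
      rfl
    change symRep n M (symRep n C⁻¹ _) = _ • symRep n C⁻¹ _
    rw [← Module.End.mul_apply, ← map_mul, h1, map_mul, Module.End.mul_apply, h2, map_smul]
  have hdiag : LinearMap.toMatrix D D (symRep n M) =
      Matrix.diagonal fun i : Fin n => z ^ ((n : ℤ) - 1 - 2 * (i : ℕ)) := by
    ext i i'
    rw [LinearMap.toMatrix_apply, heig, map_smul, D.repr_self, Matrix.diagonal_apply]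
    by_cases hi : i = i'
    · simp [hi]
    · simp [hi]
  let f : Matrix (Fin n) (Fin n) ℂ →+* Matrix (Fin n) (Fin n) K := (algebraMap ℂ K).mapMatrix
  have hf : LinearMap.toMatrix B B (symRep n M) = B.toMatrix D * LinearMap.toMatrix D D (symRep n M)
      * D.toMatrix B := by
    rw [basis_toMatrix_mul_linearMap_toMatrix_mul_basis_toMatrix]
  have h1 : f (B.toMatrix D) * f (D.toMatrix B) = 1 := by
    rw [← map_mul, Module.Basis.toMatrix_mul_toMatrix_flip, map_one]
  have h2 : f (D.toMatrix B) * f (B.toMatrix D) = 1 := by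
    rw [← map_mul, Module.Basis.toMatrix_mul_toMatrix_flip, map_one]
  have h3 : s • (LinearMap.toMatrix B B (symRep n M)).map (algebraMap ℂ K) - 1 =
      f (B.toMatrix D) * (Matrix.diagonal fun i : Fin n =>
        s * algebraMap ℂ K (z ^ ((n : ℤ) - 1 - 2 * (i : ℕ))) - 1) * f (D.toMatrix B) := by
    have h4 : (LinearMap.toMatrix B B (symRep n M)).map (algebraMap ℂ K) =
        f (B.toMatrix D) * f (LinearMap.toMatrix D D (symRep n M)) * f (D.toMatrix B) := by
      rw [← map_mul, ← map_mul, ← hf]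
      rfl
    have h5 : (Matrix.diagonal fun i : Fin n =>
        s * algebraMap ℂ K (z ^ ((n : ℤ) - 1 - 2 * (i : ℕ))) - 1) =
        s • f (LinearMap.toMatrix D D (symRep n M)) - 1 := by
      rw [hdiag, ← Matrix.diagonal_one]
      ext i i'
      by_cases hi : i = i'
      · simp [hi, f]
      · simp [hi, f]
    rw [h4, h5, mul_sub, sub_mul, mul_one, h1, mul_smul_comm, smul_mul_assoc]
  rw [h3, Matrix.det_conj_of_mul_eq_one h1 h2, Matrix.det_diagonal,
    Fin.prod_univ_eq_prod_range
      (fun i => s * algebraMap ℂ K (z ^ ((n : ℤ) - 1 - 2 * (i : ℕ))) - 1)]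

theorem IsConjDiag.pow {M : SL(2, ℂ)} {z : ℂ} (h : IsConjDiag M z) (r : ℕ) :
    IsConjDiag (M ^ r) (z ^ r) := by
  obtain ⟨C, hC⟩ := h
  refine ⟨C, ?_⟩
  rw [← conj_pow, Matrix.SpecialLinearGroup.coe_pow, hC]
  induction r with
  | zero => simp [Matrix.one_fin_two]
  | succ r ih =>
    rw [pow_succ, ih, Matrix.mul_fin_two]
    simp [pow_succ, mul_comm]

end Sym

/-! ### Products over the eigenvalues -/

section Products

variable {K : Type*} [Field K] [Algebra ℂ K]

theorem mul_eq_cosFactor (u : K) {z : ℂ} {θ : ℝ} (hz : z = Complex.exp (Complex.I * θ)) (k : ℤ) :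
    (u * algebraMap ℂ K (z ^ k) - 1) * (u * algebraMap ℂ K (z ^ (-k)) - 1) =
      cosFactor u (k * θ) := by
  have hz0 : z ≠ 0 := hz ▸ Complex.exp_ne_zero _
  have h1 : algebraMap ℂ K (z ^ k) * algebraMap ℂ K (z ^ (-k)) = 1 := by
    rw [← map_mul, ← zpow_add₀ hz0, add_neg_cancel, zpow_zero, map_one]
  have h2 : algebraMap ℂ K (2 * (Real.cos (k * θ) : ℂ)) =
      algebraMap ℂ K (z ^ k) + algebraMap ℂ K (z ^ (-k)) := by
    rw [← map_add]
    congr 1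
    rw [Complex.ofReal_cos, Complex.two_cos, hz, ← Complex.exp_int_mul, ← Complex.exp_int_mul]
    push_cast
    congr 2 <;> ring
  rw [cosFactor, h2]
  linear_combination u ^ 2 * h1

theorem prod_eigenvalues_add_two (u : K) (z : ℂ) (n : ℕ) :
    ∏ i ∈ Finset.range (n + 2),
      (u * algebraMap ℂ K (z ^ (((n + 2 : ℕ) : ℤ) - 1 - 2 * (i : ℕ))) - 1) =
    (∏ i ∈ Finset.range n, (u * algebraMap ℂ K (z ^ ((n : ℤ) - 1 - 2 * (i : ℕ))) - 1)) *
      ((u * algebraMap ℂ K (z ^ ((n : ℤ) + 1)) - 1) *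
        (u * algebraMap ℂ K (z ^ (-((n : ℤ) + 1))) - 1)) := by
  rw [Finset.prod_range_succ, Finset.prod_range_succ']
  have h1 : ((n + 2 : ℕ) : ℤ) - 1 - 2 * ((0 : ℕ) : ℤ) = (n : ℤ) + 1 := by push_cast; ring
  have h2 : ((n + 2 : ℕ) : ℤ) - 1 - 2 * ((n + 1 : ℕ) : ℤ) = -((n : ℤ) + 1) := by push_cast; ring
  have h3 : ∀ i : ℕ, ((n + 2 : ℕ) : ℤ) - 1 - 2 * ((i + 1 : ℕ) : ℤ) = (n : ℤ) - 1 - 2 * (i : ℕ) :=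
    fun i => by push_cast; ring
  simp only [h1, h2, h3]
  ring

theorem prod_eigenvalues_even (u : K) {z : ℂ} {θ : ℝ} (hz : z = Complex.exp (Complex.I * θ))
    (h : ℕ) :
    ∏ i ∈ Finset.range (2 * h),
      (u * algebraMap ℂ K (z ^ (((2 * h : ℕ) : ℤ) - 1 - 2 * (i : ℕ))) - 1) =
    ∏ i ∈ Finset.range h, cosFactor u ((2 * i + 1) * θ) := by
  induction h with
  | zero => simp
  | succ h ih =>
    have := prod_eigenvalues_add_two u z (2 * h)
    rw [Finset.prod_range_succ _ h, ← ih, show 2 * (h + 1) = 2 * h + 2 by ring, this,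
      mul_eq_cosFactor u hz]
    push_cast
    rfl

theorem prod_eigenvalues_odd (u : K) {z : ℂ} {θ : ℝ} (hz : z = Complex.exp (Complex.I * θ))
    (h : ℕ) :
    ∏ i ∈ Finset.range (2 * h + 1),
      (u * algebraMap ℂ K (z ^ (((2 * h + 1 : ℕ) : ℤ) - 1 - 2 * (i : ℕ))) - 1) =
    (u - 1) * ∏ i ∈ Finset.Icc 1 h, cosFactor u (2 * i * θ) := by
  induction h with
  | zero => simp
  | succ h ih =>
    have := prod_eigenvalues_add_two u z (2 * h + 1)
    rw [Finset.prod_Icc_succ_top (by omega), ← mul_assoc, ← ih,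
      show 2 * (h + 1) + 1 = 2 * h + 1 + 2 by ring, this, mul_eq_cosFactor u hz]
    congr 2
    push_cast
    ring

/-- The case of the eigenvalue `±1`. -/
theorem prod_eigenvalues_neg_one_pow (u : K) (a n : ℕ) :
    ∏ i ∈ Finset.range n,
      (u * algebraMap ℂ K (((-1 : ℂ) ^ a) ^ ((n : ℤ) - 1 - 2 * (i : ℕ))) - 1) =
    if Even n then (u - (-1) ^ a) ^ n else (u - 1) ^ n := by
  have hw : ∀ i : ℕ, ((-1 : ℂ) ^ a) ^ ((n : ℤ) - 1 - 2 * (i : ℕ)) =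
      if Even n then (-1) ^ a else 1 := by
    intro i
    rcases neg_one_pow_eq_or ℂ a with h | h
    · simp [h]
    · rw [h]
      split_ifs with hn
      · refine Odd.neg_one_zpow ?_
        obtain ⟨r, rfl⟩ := hn
        exact ⟨r - 1 - i, by push_cast; ring⟩
      · refine Even.neg_one_zpow ?_
        obtain ⟨r, rfl⟩ := Nat.not_even_iff_odd.1 hn
        exact ⟨r - i, by push_cast; ring⟩
  simp only [hw, Finset.prod_const, Finset.card_range]
  split_ifs with hn
  · rcases neg_one_pow_eq_or K a with h | h
    · rw [map_pow, map_neg, map_one, h, mul_one]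
    · rw [map_pow, map_neg, map_one, h, ← hn.neg_pow]
      congr 1
      ring
  · simp

end Products

/-! ### Exponents of the cores -/

section Exponents

variable {μ p q : ℕ}

theorem component_arc (k : ZMod (μ * q)) (i : Fin (μ * p)) :
    component (arc k i) = ZMod.castHom (Dvd.intro q rfl) (ZMod μ) k + (i.val : ZMod μ) := rfl

theorem alphaL_meridian (a : Arc μ p q) :
    alphaL (meridian a) = Multiplicative.ofAdd (Pi.single (component a) 1) :=
  PresentedGroup.toGroup.of _

variable [NeZero μ]

/-- Among `μ r` consecutive integers each residue class modulo `μ` occurs `r` times. -/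
theorem sum_range_single (r : ℕ) :
    ∑ k ∈ Finset.range (μ * r), (Pi.single (k : ZMod μ) 1 : ZMod μ → ℤ) = fun _ => (r : ℤ) := by
  induction r with
  | zero => simp; rfl
  | succ r ih =>
    have h1 : ∑ k ∈ Finset.range μ, (Pi.single (k : ZMod μ) 1 : ZMod μ → ℤ) = fun _ => 1 := by
      funext i
      rw [Finset.sum_apply, Finset.sum_eq_single i.val]
      · simp
      · intro k hk hki
        refine Pi.single_eq_of_ne (fun h => hki ?_) _
        rw [h, ZMod.val_natCast, Nat.mod_eq_of_lt (Finset.mem_range.1 hk)]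
      · intro h
        exact absurd (Finset.mem_range.2 (ZMod.val_lt i)) h
    rw [Nat.mul_succ, Finset.sum_range_add, ih]
    simp only [Nat.cast_add, Nat.cast_mul, ZMod.natCast_self, zero_mul, zero_add, h1]
    funext i
    simp

theorem alphaL_coreX (hp : 0 < μ * p) :
    Multiplicative.toAdd (alphaL (coreX (q := q) hp)) = fun _ => (q : ℤ) := by
  have h : alphaL (coreX (q := q) hp) = ∏ k ∈ Finset.range (μ * q),
      alphaL (meridian (arc (k : ZMod (μ * q)) (⟨0, hp⟩ : Fin (μ * p)))) := by
    rw [coreX, map_list_prod, List.map_map, ((List.reverse_perm _).map _).prod_eq]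
    rfl
  rw [← sum_range_single q, h, toAdd_prod]
  refine Finset.sum_congr rfl fun k _ => ?_
  simp [alphaL_meridian, component_arc]

theorem alphaL_coreY :
    Multiplicative.toAdd (alphaL (coreY : LinkGroup μ p q)) = fun _ => (p : ℤ) := by
  rw [← sum_range_single p, coreY, map_list_prod, List.map_ofFn, List.prod_ofFn, toAdd_prod,
    ← Fin.sum_univ_eq_sum_range (fun k => (Pi.single (k : ZMod μ) 1 : ZMod μ → ℤ))]
  refine Finset.sum_congr rfl fun i _ => ?_
  simp [alphaL_meridian, component_arc]

theorem coreX_pow (hp : 0 < p) (hq : 0 < q) :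
    coreX (q := q) (Nat.mul_pos (NeZero.pos μ) hp) ^ p = coreY ^ q := by
  have : NeZero q := ⟨hq.ne'⟩
  by_cases hP : μ * p = 1
  · obtain rfl : μ = 1 := Nat.eq_one_of_mul_eq_one_right hP
    obtain rfl : p = 1 := by omega
    have h : ∀ (k : ZMod (1 * q)) (i : Fin (1 * 1)), (arc k i : Arc 1 1 q) = arc 0 0 := by
      have h1 : ∀ r : ℕ, (arc (r : ZMod (1 * q)) 0 : Arc 1 1 q) = arc 0 0 := by
        intro r
        induction r with
        | zero => simp
        | succ r ih => rw [← ih, Nat.cast_succ, ← arc_last (r : ZMod (1 * q)) (i := 0) rfl rfl]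
      intro k i
      have : Subsingleton (Fin (1 * 1)) := inferInstanceAs (Subsingleton (Fin 1))
      rw [Subsingleton.elim i 0, ← ZMod.natCast_zmod_val k, h1]
    simp [coreX, coreY, h]
  · obtain ⟨N, hN⟩ : ∃ N, N + 2 = μ * p := by
      have : 0 < μ * p := Nat.mul_pos (NeZero.pos μ) hp
      exact ⟨μ * p - 2, by omega⟩
    rw [coreX_eq_word hN, coreY_eq_word hN]
    exact Labelling.pow_eq_pow _ (by rw [hN]; ring)

end Exponents

/-! ### Laurent monomials -/

section Monomials

variable {τ : Type*}

/-- A matrix `s M - 1`, where `s` is a polynomial without constant term and `M` is a complex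
matrix, is invertible over the rational functions. -/
theorem det_smul_map_sub_one_ne_zero {n : ℕ} (S : MvPolynomial τ ℂ)
    (hS : MvPolynomial.constantCoeff S = 0) (A : Matrix (Fin n) (Fin n) ℂ) :
    (algebraMap (MvPolynomial τ ℂ) (RatFun τ) S • A.map (algebraMap ℂ (RatFun τ)) - 1).det ≠
      0 := by
  have h : algebraMap (MvPolynomial τ ℂ) (RatFun τ) S • A.map (algebraMap ℂ (RatFun τ)) - 1 =
      (algebraMap (MvPolynomial τ ℂ) (RatFun τ)).mapMatrix
        (S • A.map (MvPolynomial.C (σ := τ)) - 1) := by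
    rw [map_sub, map_one]
    congr 1
    ext i j
    simp [IsScalarTower.algebraMap_apply ℂ (MvPolynomial τ ℂ) (RatFun τ),
      MvPolynomial.algebraMap_eq]
  rw [h, ← RingHom.map_det, Ne, FaithfulSMul.algebraMap_eq_zero_iff]
  intro h0
  have h1 := congrArg MvPolynomial.constantCoeff h0
  rw [RingHom.map_det, map_zero] at h1
  have h2 : MvPolynomial.constantCoeff.mapMatrix (S • A.map (MvPolynomial.C (σ := τ)) - 1) =
      (-1 : Matrix (Fin n) (Fin n) ℂ) := by
    rw [map_sub, map_one]
    ext i j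
    simp [hS]
  rw [h2, Matrix.det_neg, Matrix.det_one, mul_one] at h1
  exact pow_ne_zero _ (neg_ne_zero.2 one_ne_zero) h1

variable [Fintype τ]

theorem tmonomial_pow (k : τ → ℤ) (n : ℕ) :
    tmonomial k ^ n = tmonomial fun i => (n : ℤ) * k i := by
  rw [tmonomial, tmonomial, ← Finset.prod_pow]
  refine Finset.prod_congr rfl fun i _ => ?_
  rw [← zpow_natCast, ← zpow_mul, mul_comm]

theorem tmonomial_const {μ : ℕ} [NeZero μ] (r : ℕ) :
    tmonomial (fun _ : ZMod μ => (r : ℤ)) = tprod μ ^ r := by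
  rw [tmonomial, tprod, ← Finset.prod_pow]
  simp

theorem tprod_pow_eq_algebraMap (μ : ℕ) [NeZero μ] (r : ℕ) :
    tprod μ ^ r = algebraMap (MvPolynomial (ZMod μ) ℂ) _ ((∏ i, MvPolynomial.X i) ^ r) := by
  rw [map_pow, map_prod]
  rfl

theorem constantCoeff_prod_X_pow (μ : ℕ) [NeZero μ] {r : ℕ} (hr : 0 < r) :
    MvPolynomial.constantCoeff ((∏ i : ZMod μ, (MvPolynomial.X i : MvPolynomial _ ℂ)) ^ r) =
      0 := by
  rw [map_pow, map_prod]
  simp [hr.ne', NeZero.ne μ]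

end Monomials

end TorusLink

end

theorem theorem5p1 (μ p q : ℕ) [NeZero μ] (hp : 0 < p) (hq : 0 < q) (hpq : Nat.Coprime p q)
    (ρ : TorusLink.LinkGroup μ p q →* Matrix.SpecialLinearGroup (Fin 2) ℂ)
    (hρ : TorusLink.IsIrred ρ)
    (a b : ℕ) (ha : a ≤ p) (hb : b ≤ q)
    (hX : TorusLink.IsConjDiag (ρ (TorusLink.coreX (Nat.mul_pos (NeZero.pos μ) hp)))
      (Complex.exp (Complex.I * Real.pi * a / p)))
    (hY : TorusLink.IsConjDiag (ρ TorusLink.coreY)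
      (Complex.exp (Complex.I * Real.pi * b / q)))
    (n : ℕ) (hn : 1 ≤ n)
    (B : Module.Basis (Fin n) ℂ (TorusLink.SymSpace n))
    (m : ℕ) (e : Fin (m + 1) ≃ TorusLink.Arc μ p q) (f : Fin m ↪ TorusLink.Crossing μ p q)
    (j : Fin (m + 1)) :
    (Even n → ∃ k : ZMod μ → ℤ,
      TorusLink.twistedAlexander ((TorusLink.symRep n).comp ρ) B e f j =
        TorusLink.tmonomial (fun i => n * k i) *
          ((TorusLink.tprod μ ^ (p * q) - (-1) ^ a) ^ (n * μ) /
            ∏ i ∈ Finset.range (n / 2),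
              (TorusLink.cosFactor (TorusLink.tprod μ ^ q) ((2 * i + 1) * a * Real.pi / p) *
                TorusLink.cosFactor (TorusLink.tprod μ ^ p) ((2 * i + 1) * b * Real.pi / q)))) ∧
    (Odd n → ∃ k : ZMod μ → ℤ, ∃ ε : ℤˣ,
      TorusLink.twistedAlexander ((TorusLink.symRep n).comp ρ) B e f j =
        ((ε : ℤ) : TorusLink.RatFun (ZMod μ)) * TorusLink.tmonomial (fun i => n * k i) *
          ((TorusLink.tprod μ ^ (p * q) - 1) ^ (n * μ) /
            ((TorusLink.tprod μ ^ p - 1) * (TorusLink.tprod μ ^ q - 1) *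
              ∏ i ∈ Finset.Icc 1 ((n - 1) / 2),
                (TorusLink.cosFactor (TorusLink.tprod μ ^ q) (2 * i * a * Real.pi / p) *
                  TorusLink.cosFactor (TorusLink.tprod μ ^ p) (2 * i * b * Real.pi / q))))) := by
  open TorusLink in
  set x : LinkGroup μ p q := coreX (Nat.mul_pos (NeZero.pos μ) hp) with hx
  have hp' : (p : ℂ) ≠ 0 := Nat.cast_ne_zero.2 hp.ne'
  have hq' : (q : ℂ) ≠ 0 := Nat.cast_ne_zero.2 hq.ne'
  let Ψ := twist alphaL ((symRep n).comp ρ) B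
  have hΨ : ∀ g, Ψ g = tmonomial (Multiplicative.toAdd (alphaL g)) •
      (LinearMap.toMatrix B B (symRep n (ρ g))).map (algebraMap ℂ (RatFun (ZMod μ))) :=
    fun _ => rfl
  -- The matrices of the two cores, of the regular fibre and of a meridian.
  have hΨx : Ψ x = tprod μ ^ q •
      (LinearMap.toMatrix B B (symRep n (ρ x))).map (algebraMap ℂ (RatFun (ZMod μ))) := by
    rw [hΨ, hx, alphaL_coreX, tmonomial_const]
  have hΨy : Ψ coreY = tprod μ ^ p •
      (LinearMap.toMatrix B B (symRep n (ρ coreY))).map (algebraMap ℂ (RatFun (ZMod μ))) := by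
    rw [hΨ, alphaL_coreY, tmonomial_const]
  have hΨh : Ψ (coreY ^ q) = tprod μ ^ (p * q) •
      (LinearMap.toMatrix B B (symRep n (ρ x ^ p))).map (algebraMap ℂ (RatFun (ZMod μ))) := by
    have h1 : (Multiplicative.toAdd (alphaL ((coreY : LinkGroup μ p q) ^ q))) =
        fun _ => ((p * q : ℕ) : ℤ) := by
      rw [map_pow, toAdd_pow, alphaL_coreY]
      funext i
      simp [mul_comm]
    rw [hΨ, h1, tmonomial_const, ← map_pow, hx, coreX_pow hp hq]
  have hdx : (Ψ x - 1).det ≠ 0 := by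
    rw [hΨx, tprod_pow_eq_algebraMap]
    exact det_smul_map_sub_one_ne_zero _ (constantCoeff_prod_X_pow μ hq) _
  have hdy : (Ψ coreY - 1).det ≠ 0 := by
    rw [hΨy, tprod_pow_eq_algebraMap]
    exact det_smul_map_sub_one_ne_zero _ (constantCoeff_prod_X_pow μ hp) _
  have hdj : (Ψ (meridian (e j)) - 1).det ≠ 0 := by
    have h1 : tmonomial (Multiplicative.toAdd (alphaL (meridian (e j)))) =
        algebraMap (MvPolynomial (ZMod μ) ℂ) (RatFun (ZMod μ))
          (MvPolynomial.X (component (e j))) := by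
      rw [alphaL_meridian, tmonomial, Finset.prod_eq_single (component (e j))]
      · simp [tvar]
      · intro i _ hi
        simp [hi]
      · simp
    rw [hΨ, h1]
    exact det_smul_map_sub_one_ne_zero _ (by simp) _
  have hdet : ∀ g, (Ψ g).det =
      tmonomial fun i => (n : ℤ) * Multiplicative.toAdd (alphaL g) i := by
    intro g
    rw [hΨ, Matrix.det_smul, Fintype.card_fin, tmonomial_pow]
    have h1 := (RingHom.map_det (algebraMap ℂ (RatFun (ZMod μ)))
      (LinearMap.toMatrix B B (symRep n (ρ g)))).symm
    rw [LinearMap.det_toMatrix, det_symRep, map_one] at h1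
    rw [show ((LinearMap.toMatrix B B (symRep n (ρ g))).map
      (algebraMap ℂ (RatFun (ZMod μ)))).det = 1 from h1, mul_one]
  obtain ⟨ε, g, h⟩ := exists_det_minor hp hq hpq Ψ e f j hdx hdy hdj
  have hkey : twistedAlexander ((symRep n).comp ρ) B e f j =
      ((ε : ℤ) : RatFun (ZMod μ)) ^ n *
        (tmonomial fun i => (n : ℤ) * Multiplicative.toAdd (alphaL g) i) *
        ((Ψ (coreY ^ q) - 1).det ^ μ / ((Ψ x - 1).det * (Ψ coreY - 1).det)) := by
    have h1 : (Ψ.comp (FreeGroup.lift fun i => meridian (e i))) (FreeGroup.of j) =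
        Ψ (meridian (e j)) := by
      simp
    simp only [twistedAlexander, wada]
    change _ / ((Ψ.comp (FreeGroup.lift fun i => meridian (e i))) (FreeGroup.of j) - 1).det = _
    rw [h1, ← hdet, ← mul_div_assoc, div_eq_div_iff hdj (mul_ne_zero hdx hdy), ← mul_assoc]
    exact h
  -- The core eigenvalues in polar form; the regular fibre `x ^ p` has the eigenvalue `(-1) ^ a`.
  have hzx : Complex.exp (Complex.I * Real.pi * a / p) =
      Complex.exp (Complex.I * ((a * Real.pi / p : ℝ) : ℂ)) := by
    congr 1
    push_cast
    ring
  have hzy : Complex.exp (Complex.I * Real.pi * b / q) =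
      Complex.exp (Complex.I * ((b * Real.pi / q : ℝ) : ℂ)) := by
    congr 1
    push_cast
    ring
  have hzh : Complex.exp (Complex.I * Real.pi * a / p) ^ p = (-1) ^ a := by
    rw [← Complex.exp_nat_mul, ← Complex.exp_pi_mul_I, ← Complex.exp_nat_mul]
    congr 1
    field_simp
  have hXp := hX.pow p
  rw [hzh] at hXp
  have hdh : (Ψ (coreY ^ q) - 1).det = if Even n then (tprod μ ^ (p * q) - (-1) ^ a) ^ n
      else (tprod μ ^ (p * q) - 1) ^ n := by
    rw [hΨh, det_smul_symRep_sub_one B hXp (by simp), prod_eigenvalues_neg_one_pow]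
  have hdx' := det_smul_symRep_sub_one B hX (Complex.exp_ne_zero _) (tprod μ ^ q)
  have hdy' := det_smul_symRep_sub_one B hY (Complex.exp_ne_zero _) (tprod μ ^ p)
  rw [← hΨx] at hdx'
  rw [← hΨy] at hdy'
  rw [hdh] at hkey
  constructor
  · intro he
    refine ⟨Multiplicative.toAdd (alphaL g), ?_⟩
    have hε : ((ε : ℤ) : RatFun (ZMod μ)) ^ n = 1 := by
      rcases Int.units_eq_one_or ε with h1 | h1 <;> simp [h1, he.neg_one_pow]
    rw [hkey, if_pos he, hε, one_mul, ← pow_mul, hdx', hdy', Finset.prod_mul_distrib]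
    obtain ⟨r, hr⟩ := even_iff_exists_two_mul.1 he
    subst hr
    rw [prod_eigenvalues_even _ hzx, prod_eigenvalues_even _ hzy, Nat.mul_div_cancel_left r two_pos]
    simp only [mul_div_assoc, mul_assoc]
  · intro ho
    refine ⟨Multiplicative.toAdd (alphaL g), ε, ?_⟩
    have hε : ((ε : ℤ) : RatFun (ZMod μ)) ^ n = ((ε : ℤ) : RatFun (ZMod μ)) := by
      rcases Int.units_eq_one_or ε with h1 | h1 <;> simp [h1, ho.neg_one_pow]
    rw [hkey, if_neg (Nat.not_even_iff_odd.2 ho), hε, ← pow_mul, hdx', hdy',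
      Finset.prod_mul_distrib]
    obtain ⟨r, hr⟩ := ho
    subst hr
    rw [prod_eigenvalues_odd _ hzx, prod_eigenvalues_odd _ hzy, Nat.add_sub_cancel,
      Nat.mul_div_cancel_left r two_pos]
    simp only [mul_div_assoc, mul_assoc]
    congr 3
    ring
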